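/- Let $\Psi:(0,\infty)\to(0,\infty)$ and $\omega:(0,\infty)\to(0,1)$ be functions. Let $E(\Psi,\omega)$ be the set of $x\in\mathbb R$ such that $|x-p/q|\le\Psi(q)$ for infinitely many $(p,q)\in\mathbb Z\times\mathbb N$ and such that, for all sufficiently large $q\in\mathbb N$, $|x-p/q|\ge(1-\omega(q))\Psi(q)$ for every $p\in\mathbb Z$ (here $\mathbb N=\{1,2,\dots\}$). Assume that - $q\mapsto q^2\Psi(q)$ and $q\mapsto q^2\Psi(q)\omega(q)$ are non-increasing on $(0,\infty)$; - $\Psi$ satisfies the square divisibility condition: for every $q\in\mathbb N$, $\Psi(q)^{-1}$ is an integer divisible by $q^2$; - $\sum_{q=1}^\infty q\Psi(q)<\infty$ and $\lim_{q\to\infty}\omega(q)=0$; - for all sufficiently large $q\in\mathbb N$, $\omega(q)\ge\frac{45}{16\,\Psi(q)}\,\Psi\!\left(\frac{1}{8\Psi(q)}\right)$. Then the Hausdorff dimension of $E(\Psi,\omega)$ is $$\dim_H E(\Psi,\omega)=\inf\Big\{s\ge 0:\ \sum_{q=1}^\infty q\,(\Psi(q)\omega(q))^s<\infty\Big\}=\frac{2}{\lambda(\Psi,\omega)},$$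 where $$\lambda(\Psi,\omega)=\liminf_{q\to\infty}\frac{-\log(\Psi(q)\omega(q))}{\log q}\in(0,\infty]$$ is the lower order at infinity of $\Psi\cdot\omega$ ($q$ ranging over the reals), and $2/\infty=0$. -/

import Mathlib

open Filter Set Topology
open scoped NNReal ENNReal

/-- The set `W(Ψ)` of `Ψ`-approximable real numbers: those `x` for which
`|x - p / q| ≤ Ψ q` holds for infinitely many pairs `(p, q)` of an integer `p` and a
positive integer `q` (not assumed coprime). -/
def approximableSet (Ψ : ℝ → ℝ) : Set ℝ :=
  {x | {r : ℤ × ℕ | 0 < r.2 ∧ |x - (r.1 : ℝ) / (r.2 : ℝ)| ≤ Ψ (r.2 : ℝ)}.Infinite}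

/-- The set `E(Ψ, ω)` of real numbers of exact `(Ψ, ω)`-order of approximation. -/
def exactSet (Ψ ω : ℝ → ℝ) : Set ℝ :=
  {x | x ∈ approximableSet Ψ ∧
    ∀ᶠ q : ℕ in atTop, ∀ p : ℤ, (1 - ω q) * Ψ q ≤ |x - (p : ℝ) / (q : ℝ)|}

/-- The square divisibility condition: for every positive integer `q`, the number `1 / Ψ q`
is an integer multiple of `q ^ 2`. -/
def SquareDivisibility (Ψ : ℝ → ℝ) : Prop :=
  ∀ q : ℕ, 0 < q → ∃ m : ℤ, (Ψ q)⁻¹ = (q : ℝ) ^ 2 * (m : ℝ)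

/-- The infimum, in `[0, ∞]`, of the real `s ≥ 0` for which `∑_{q ≥ 1} q (Ψ q ω q) ^ s` converges.
The term of index `q = 0` in the series below is zero because of its first factor. -/
noncomputable def convergenceExponent (Ψ ω : ℝ → ℝ) : ℝ≥0∞ :=
  sInf {t : ℝ≥0∞ | ∃ s : ℝ≥0, t = (s : ℝ≥0∞) ∧
    Summable fun q : ℕ => (q : ℝ) * (Ψ q * ω q) ^ (s : ℝ)}

/-- The lower order at infinity `λ(Ψ, ω)` of `Ψ ω`, as an extended real number: the lower limit of
`-log (Ψ q ω q) / log q` as the real variable `q` tends to infinity. -/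
noncomputable def lowerOrder (Ψ ω : ℝ → ℝ) : EReal :=
  liminf (fun q : ℝ => ((-Real.log (Ψ q * ω q) / Real.log q : ℝ) : EReal)) atTop

/-! Upper bound. A point of the exact set lies, for infinitely many `q`, in an interval of length `Ψ
q * ω q` at one end of a ball of radius `Ψ q` about some `p / q`. There are `O(q)` such intervals
per unit length, so convergence of `∑ q (Ψ q ω q) ^ s` bounds the `s`-dimensional measure of
countably many pieces.

Lower bound. A tree of rationals is grown, each child `u` inside the contact interval of its parent
`w`, with nested contact intervals. The danger is a rational `v` of intermediate denominator whose
ball swallows the contact interval of `w`. Square divisibility makes the right endpoint `w + Ψ d`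
rational with denominator dividing `1 / Ψ d`. The distance from `v` to this endpoint is then
governed by an integer `b`, and remoteness of `w` bounds `|b|` below when `b ≠ 0`. If `b = 0`, then
`v` is the endpoint itself, and the lower bound on `ω` makes `Ψ` small at its denominator. This is
`le_of_close_to_contactInterval`.

The bad balls then cover at most a quarter of the contact interval (`volume_iUnion_closedBall_le`),
while by Dirichlet's theorem most points have a neighbour of denominator comparable to `X`
(`eventually_volume_not_approximable_le`). Hence about `X ^ 2 * (Ψ d * ω d)` children survive, and
they are remote again (`eventually_exists_children`). For `s` below the convergence exponent, `X ^ 2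
* (Ψ X * ω X) ^ s` is unbounded; taking the scales `X` where it is large, the mass distribution
principle (`le_dimH_of_tree`) gives dimension at least `s`.

The value `2 / λ` comes from comparing `Ψ ω` with powers of `q`. -/

/-- The hypotheses on the pair `(Ψ, ω)` under which the dimension of `exactSet Ψ ω` is computed. -/
structure Admissible (Ψ ω : ℝ → ℝ) : Prop where
  pos : ∀ q : ℝ, 0 < q → 0 < Ψ q
  omega_mem : ∀ q : ℝ, 0 < q → 0 < ω q ∧ ω q < 1
  anti : AntitoneOn (fun q : ℝ => q ^ 2 * Ψ q) (Ioi 0)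
  anti_mul : AntitoneOn (fun q : ℝ => q ^ 2 * Ψ q * ω q) (Ioi 0)
  div : SquareDivisibility Ψ
  sum : Summable fun q : ℕ => (q : ℝ) * Ψ q
  lim : Tendsto ω atTop (𝓝 0)
  ge : ∀ᶠ q : ℕ in atTop, 45 / (16 * Ψ q) * Ψ (1 / (8 * Ψ q)) ≤ ω q

/-! ### Monotonicity and decay of `Ψ` and `Ψ ω` -/

lemma le_of_sq_mul_le {a b x y : ℝ} (ha : 0 < a) (hab : a ≤ b) (hy : 0 ≤ y)
    (h : b ^ 2 * x ≤ a ^ 2 * y) : x ≤ y := by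
  have h1 : a ^ 2 * y ≤ b ^ 2 * y := by gcongr
  exact le_of_mul_le_mul_left (h.trans h1) (by have := ha.trans_le hab; positivity)

namespace Admissible

variable {Ψ ω : ℝ → ℝ}

lemma mul_pos (h : Admissible Ψ ω) {q : ℝ} (hq : 0 < q) : 0 < Ψ q * ω q :=
  _root_.mul_pos (h.pos q hq) (h.omega_mem q hq).1

lemma mul_le (h : Admissible Ψ ω) {q : ℝ} (hq : 0 < q) : Ψ q * ω q ≤ Ψ q :=
  mul_le_of_le_one_right (h.pos q hq).le (h.omega_mem q hq).2.le

lemma sq_mul_le (h : Admissible Ψ ω) {a b : ℝ} (ha : 0 < a) (hab : a ≤ b) :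
    b ^ 2 * Ψ b ≤ a ^ 2 * Ψ a :=
  h.anti ha (ha.trans_le hab) hab

lemma le (h : Admissible Ψ ω) {a b : ℝ} (ha : 0 < a) (hab : a ≤ b) : Ψ b ≤ Ψ a :=
  le_of_sq_mul_le ha hab (h.pos a ha).le (h.sq_mul_le ha hab)

lemma sq_mul_mul_le (h : Admissible Ψ ω) {a b : ℝ} (ha : 0 < a) (hab : a ≤ b) :
    b ^ 2 * (Ψ b * ω b) ≤ a ^ 2 * (Ψ a * ω a) := by
  simpa only [mul_assoc] using h.anti_mul ha (ha.trans_le hab) hab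

lemma mul_anti (h : Admissible Ψ ω) {a b : ℝ} (ha : 0 < a) (hab : a ≤ b) :
    Ψ b * ω b ≤ Ψ a * ω a :=
  le_of_sq_mul_le ha hab (h.mul_pos ha).le (h.sq_mul_mul_le ha hab)

lemma tendsto_mul_zero (h : Admissible Ψ ω) :
    Tendsto (fun q : ℕ => (q : ℝ) * Ψ q) atTop (𝓝 0) := h.sum.tendsto_atTop_zero

lemma tendsto_zero (h : Admissible Ψ ω) : Tendsto (fun q : ℕ => Ψ q) atTop (𝓝 0) := by
  refine squeeze_zero' ?_ ?_ h.tendsto_mul_zero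
  · filter_upwards [eventually_ge_atTop 1] with n hn
    exact (h.pos n (by positivity)).le
  · filter_upwards [eventually_ge_atTop 1] with n hn
    exact le_mul_of_one_le_left (h.pos n (by positivity)).le (by exact_mod_cast hn)

lemma tendsto_mul_omega_zero (h : Admissible Ψ ω) :
    Tendsto (fun q : ℕ => Ψ q * ω q) atTop (𝓝 0) := by
  refine squeeze_zero' ?_ ?_ h.tendsto_zero
  · filter_upwards [eventually_ge_atTop 1] with n hn
    exact (h.mul_pos (q := n) (by positivity)).le
  · filter_upwards [eventually_ge_atTop 1] with n hn
    exact h.mul_le (by positivity)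

/-! ### The convergence exponent and the lower order -/

lemma summable_of_lt_lowerOrder (h : Admissible Ψ ω) {s μ : ℝ} (hs : 0 ≤ s)
    (hμ : (μ : EReal) < lowerOrder Ψ ω) (hsμ : 2 < s * μ) :
    Summable fun q : ℕ => (q : ℝ) * (Ψ q * ω q) ^ s := by
  have h1 : ∀ᶠ q : ℝ in atTop, (μ : EReal) < ((-Real.log (Ψ q * ω q) / Real.log q : ℝ) : EReal) :=
    eventually_lt_of_lt_liminf hμ
  have h2 := (h1.and (eventually_gt_atTop (1 : ℝ)))
  have h3 := tendsto_natCast_atTop_atTop (R := ℝ) |>.eventually h2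
  have hsum : Summable fun n : ℕ => (n : ℝ) ^ (1 - s * μ) :=
    Real.summable_nat_rpow.2 (by linarith)
  refine Summable.of_norm_bounded_eventually_nat hsum ?_
  filter_upwards [h3] with n hn
  obtain ⟨hn1, hn2⟩ := hn
  have hn0 : (0 : ℝ) < n := by linarith
  have hf := h.mul_pos hn0
  have hlog := Real.log_pos hn2
  have hn3 : μ < -Real.log (Ψ n * ω n) / Real.log n := by exact_mod_cast hn1
  rw [lt_div_iff₀ hlog] at hn3
  have hle : Ψ n * ω n ≤ (n : ℝ) ^ (-μ) := by
    rw [Real.rpow_def_of_pos hn0, ← Real.log_le_iff_le_exp hf]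
    nlinarith
  rw [Real.norm_of_nonneg (by positivity)]
  calc (n : ℝ) * (Ψ n * ω n) ^ s ≤ n * ((n : ℝ) ^ (-μ)) ^ s := by gcongr
    _ = (n : ℝ) ^ (1 - s * μ) := by
      rw [← Real.rpow_mul hn0.le, sub_eq_add_neg, Real.rpow_add hn0, Real.rpow_one]
      ring_nf

/-- As `Ψ ω` is nonincreasing, one real `q` with `Ψ q * ω q ≥ q ^ (-μ)` bounds every term of index
`k ≤ q` below, and the partial sum up to `q` is at least `q ^ (2 - s * μ) / 8`, which is unbounded.
-/
lemma not_summable_of_lowerOrder_lt (h : Admissible Ψ ω) {s μ : ℝ} (hs : 0 ≤ s)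
    (hμ : lowerOrder Ψ ω < μ) (hsμ : s * μ < 2) :
    ¬ Summable fun q : ℕ => (q : ℝ) * (Ψ q * ω q) ^ s := by
  intro hsum
  have h1 : ∃ᶠ q : ℝ in atTop, ((-Real.log (Ψ q * ω q) / Real.log q : ℝ) : EReal) < (μ : EReal) :=
    frequently_lt_of_liminf_lt (by isBoundedDefault) hμ
  have h2 : Tendsto (fun q : ℝ => q ^ (2 - s * μ)) atTop atTop :=
    tendsto_rpow_atTop (by linarith)
  set B := ∑' q : ℕ, (q : ℝ) * (Ψ q * ω q) ^ s
  obtain ⟨q, hq1, hq2, hq3⟩ := (h1.and_eventually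
    ((h2.eventually_gt_atTop (8 * B)).and (eventually_gt_atTop (1 : ℝ)))).exists
  have hq0 : 0 < q := by linarith
  have hf := h.mul_pos hq0
  have hq1 : -Real.log (Ψ q * ω q) / Real.log q < μ := by exact_mod_cast hq1
  rw [div_lt_iff₀ (Real.log_pos hq3)] at hq1
  have hge : q ^ (-μ) ≤ Ψ q * ω q := by
    rw [Real.rpow_def_of_pos hq0, ← Real.le_log_iff_exp_le hf]
    nlinarith
  have hge' : q ^ (-(s * μ)) ≤ (Ψ q * ω q) ^ s := by
    calc q ^ (-(s * μ)) = (q ^ (-μ)) ^ s := by rw [← Real.rpow_mul hq0.le]; ring_nf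
      _ ≤ _ := by gcongr
  set n := ⌊q⌋₊
  have hnq : (n : ℝ) ≤ q := Nat.floor_le hq0.le
  have hqn : q < n + 1 := Nat.lt_floor_add_one q
  have hsumle : ∑ k ∈ Finset.range (n + 1), (k : ℝ) * (Ψ k * ω k) ^ s ≤ B := by
    refine hsum.sum_le_tsum _ fun k _ => ?_
    rcases Nat.eq_zero_or_pos k with rfl | hk
    · simp
    · have := h.mul_pos (q := k) (by positivity)
      positivity
  have hsumge : ∑ k ∈ Finset.range (n + 1), (k : ℝ) * (Ψ q * ω q) ^ s ≤
      ∑ k ∈ Finset.range (n + 1), (k : ℝ) * (Ψ k * ω k) ^ s := by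
    refine Finset.sum_le_sum fun k hk => ?_
    rcases Nat.eq_zero_or_pos k with rfl | hk'
    · simp
    · have hkn : k ≤ n := by simpa [Nat.lt_succ_iff] using hk
      have hkq : (k : ℝ) ≤ q := le_trans (by exact_mod_cast hkn) hnq
      have := h.mul_anti (a := k) (b := q) (by positivity) hkq
      gcongr
  have hgauss : (∑ k ∈ Finset.range (n + 1), (k : ℝ)) * 2 = n * (n + 1) := by
    have := Finset.sum_range_id_mul_two (n + 1)
    rw [Nat.add_sub_cancel] at this
    rw [← Nat.cast_sum]
    exact_mod_cast this.trans (mul_comm _ _)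
  rw [← Finset.sum_mul] at hsumge
  have hn1 : (1 : ℝ) ≤ n := by exact_mod_cast (Nat.le_floor_iff hq0.le).2 (by simpa using hq3.le)
  have hsq : q ^ 2 / 8 ≤ ∑ k ∈ Finset.range (n + 1), (k : ℝ) := by nlinarith
  have hpow : q ^ (2 - s * μ) = q ^ 2 * q ^ (-(s * μ)) := by
    rw [sub_eq_add_neg, Real.rpow_add hq0]; norm_cast
  have : q ^ 2 / 8 * q ^ (-(s * μ)) ≤
      (∑ k ∈ Finset.range (n + 1), (k : ℝ)) * (Ψ q * ω q) ^ s := by gcongr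
  linarith

/-- `Ψ ω` is `O(q ^ (-2))`. The bound 1 is not sharp; it only keeps `2 / λ` away from the degenerate
values of the division. -/
lemma one_le_lowerOrder (h : Admissible Ψ ω) : 1 ≤ lowerOrder Ψ ω := by
  refine le_liminf_of_le (by isBoundedDefault) ?_
  filter_upwards [eventually_gt_atTop (1 : ℝ), eventually_ge_atTop (Ψ 1 * ω 1)] with q hq hq'
  have hq0 : 0 < q := by linarith
  have h1 := h.sq_mul_mul_le one_pos hq.le
  have h2 : Ψ q * ω q ≤ q⁻¹ := by
    rw [le_inv_comm₀ (h.mul_pos hq0) hq0, ← one_div, le_div_iff₀ (h.mul_pos hq0)]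
    nlinarith
  have h3 := Real.log_le_log (h.mul_pos hq0) h2
  rw [Real.log_inv] at h3
  have : (1 : ℝ) ≤ -Real.log (Ψ q * ω q) / Real.log q := by
    rw [le_div_iff₀ (Real.log_pos hq)]
    linarith
  exact_mod_cast this

lemma convergenceExponent_eq (h : Admissible Ψ ω) :
    ((convergenceExponent Ψ ω : ℝ≥0∞) : EReal) = 2 / lowerOrder Ψ ω := by
  have h1 := h.one_le_lowerOrder
  induction hl : lowerOrder Ψ ω with
  | bot => exact absurd (hl ▸ h1) (by decide)
  | top =>
    have : convergenceExponent Ψ ω = 0 := by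
      refine le_antisymm (ENNReal.le_of_forall_pos_le_add fun ε hε _ => ?_) bot_le
      rw [zero_add]
      refine sInf_le ⟨ε, rfl, h.summable_of_lt_lowerOrder (μ := 3 / ε) ε.2 ?_ ?_⟩
      · rw [hl]; exact EReal.coe_lt_top _
      · have : (0 : ℝ) < ε := by exact_mod_cast hε
        rw [mul_div_cancel₀ _ this.ne']; norm_num
    rw [this]; simp
  | coe r =>
    rw [hl] at h1
    have hr : 1 ≤ r := by exact_mod_cast h1
    have hr0 : 0 < r := by linarith
    have : convergenceExponent Ψ ω = ENNReal.ofReal (2 / r) := by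
      refine le_antisymm (ENNReal.le_of_forall_pos_le_add fun ε hε _ => ?_) (le_sInf ?_)
      · have hε' : (0 : ℝ) < ε := by exact_mod_cast hε
        refine sInf_le ⟨(2 / r).toNNReal + ε, by push_cast; rfl, ?_⟩
        have hc : (((2 / r).toNNReal + ε : ℝ≥0) : ℝ) = 2 / r + ε := by
          push_cast; rw [Real.coe_toNNReal _ (by positivity)]
        rw [hc]
        have hsp : 0 < 2 / r + ε := by positivity
        have hlt : 2 / (2 / r + ε) < r := by
          rw [div_lt_iff₀ hsp, mul_add, mul_div_cancel₀ _ hr0.ne']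
          linarith [_root_.mul_pos hr0 hε']
        obtain ⟨μ, hμ1, hμ2⟩ := exists_between hlt
        refine h.summable_of_lt_lowerOrder (μ := μ) hsp.le ?_ ?_
        · rw [hl]; exact_mod_cast hμ2
        · rwa [div_lt_iff₀ hsp, mul_comm] at hμ1
      · rintro t ⟨s, rfl, hs⟩
        by_contra hlt
        rw [not_le, ← ENNReal.ofReal_coe_nnreal, ENNReal.ofReal_lt_ofReal_iff (by positivity),
          lt_div_iff₀ hr0] at hlt
        have hs0 : (0 : ℝ) ≤ s := s.2
        -- This `μ` exceeds `r`, yet `s * μ = s * r + (s / (s + 1)) * (2 - s * r) < 2`; the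
        -- denominator `s + 1` also serves `s = 0`.
        refine h.not_summable_of_lowerOrder_lt (μ := r + (2 - s * r) / (s + 1)) hs0 ?_ ?_ hs
        · rw [hl]
          have : 0 < (2 - s * r) / ((s : ℝ) + 1) := div_pos (by linarith) (by linarith)
          exact_mod_cast (by linarith : r < r + (2 - s * r) / ((s : ℝ) + 1))
        · have : (s : ℝ) * ((2 - s * r) / (s + 1)) < 2 - s * r := by
            rw [← mul_div_assoc, div_lt_iff₀ (by linarith)]
            nlinarith
          linarith
    rw [this, EReal.coe_ennreal_ofReal, max_eq_left (by positivity), EReal.coe_div]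
    rfl

/-! ### The upper bound for the dimension -/

lemma hausdorffMeasure_exactSet_ne_top (h : Admissible Ψ ω) {s : ℝ} (hs : 0 < s)
    (hsum : Summable fun q : ℕ => (q : ℝ) * (Ψ q * ω q) ^ s) (N : ℤ) (q₀ : ℕ) :
    MeasureTheory.Measure.hausdorffMeasure s {x : ℝ | x ∈ approximableSet Ψ ∧ (N : ℝ) ≤ x ∧ x ≤ N + 1 ∧
      ∀ q : ℕ, q₀ ≤ q → ∀ p : ℤ, (1 - ω q) * Ψ q ≤ |x - (p : ℝ) / (q : ℝ)|} ≠ ⊤ := by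
  classical
  -- Once `q * Ψ q ≤ 1`, a point of `[N, N + 1]` can only be served by the `q + 3` numerators from
  -- `N q - 1` to `N q + q + 1`.
  let c : (q : ℕ) → Fin (q + 3) → ℝ := fun q j => ((N * q - 1 + (j : ℕ) : ℤ) : ℝ) / q
  let t : (n : ℕ) → (Σ q : ℕ, Fin (q + 3) × Bool) → Set ℝ := fun n i =>
    if i.1 < n ∨ i.1 = 0 then ∅ else
      if i.2.2 then Icc (c i.1 i.2.1 + (1 - ω i.1) * Ψ i.1) (c i.1 i.2.1 + Ψ i.1)
      else Icc (c i.1 i.2.1 - Ψ i.1) (c i.1 i.2.1 - (1 - ω i.1) * Ψ i.1)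
  have hdiam : ∀ n i, Metric.ediam (t n i) ≤
      if i.1 < n ∨ i.1 = 0 then 0 else ENNReal.ofReal (Ψ i.1 * ω i.1) := by
    rintro n ⟨q, j, b⟩
    by_cases hq : q < n ∨ q = 0
    · simp [t, hq]
    · cases b
      · simp only [t, hq, if_false, Real.ediam_Icc, Bool.false_eq_true]
        refine ENNReal.ofReal_le_ofReal (le_of_eq ?_)
        ring
      · simp only [t, hq, if_false, if_true, Real.ediam_Icc]
        refine ENNReal.ofReal_le_ofReal (le_of_eq ?_)
        ring
  have hr : Tendsto (fun n : ℕ => ENNReal.ofReal (Ψ n * ω n)) atTop (𝓝 0) := by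
    simpa using ENNReal.tendsto_ofReal h.tendsto_mul_omega_zero
  have key := MeasureTheory.Measure.hausdorffMeasure_le_liminf_tsum s
    {x : ℝ | x ∈ approximableSet Ψ ∧ (N : ℝ) ≤ x ∧ x ≤ N + 1 ∧
      ∀ q : ℕ, q₀ ≤ q → ∀ p : ℤ, (1 - ω q) * Ψ q ≤ |x - (p : ℝ) / (q : ℝ)|} _ hr t ?_ ?_
  · refine ne_top_of_le_ne_top ?_ (key.trans (liminf_le_of_frequently_le' (x :=
      ∑' q : ℕ, ENNReal.ofReal (8 * ((q : ℝ) * (Ψ q * ω q) ^ s))) (Eventually.frequently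
        (Eventually.of_forall fun n => ?_))))
    · exact (hsum.mul_left 8).tsum_ofReal_ne_top
    · rw [ENNReal.tsum_sigma' (f := fun i => Metric.ediam (t n i) ^ s)]
      refine ENNReal.tsum_le_tsum fun q => ?_
      rw [tsum_fintype]
      by_cases hq : q < n ∨ q = 0
      · refine le_trans (le_of_eq ?_) bot_le
        refine Finset.sum_eq_zero fun j _ => ?_
        have := hdiam n ⟨q, j⟩
        simp only [hq, if_true, nonpos_iff_eq_zero] at this
        rw [this, ENNReal.zero_rpow_of_pos hs]
      · have hq1 : 1 ≤ q := by omega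
        have hf := h.mul_pos (q := q) (by positivity)
        calc ∑ j : Fin (q + 3) × Bool, Metric.ediam (t n ⟨q, j⟩) ^ s
            ≤ ∑ j : Fin (q + 3) × Bool, ENNReal.ofReal ((Ψ q * ω q) ^ s) := by
              refine Finset.sum_le_sum fun j _ => ?_
              rw [← ENNReal.ofReal_rpow_of_pos hf]
              have := hdiam n ⟨q, j⟩
              simp only [hq, if_false] at this
              gcongr
          _ = ENNReal.ofReal (((q + 3) * 2 : ℕ) * (Ψ q * ω q) ^ s) := by
              rw [ENNReal.ofReal_mul (by positivity), ENNReal.ofReal_natCast]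
              simp [mul_comm]
          _ ≤ _ := by
              refine ENNReal.ofReal_le_ofReal ?_
              rw [← mul_assoc]
              gcongr
              push_cast
              have : (1 : ℝ) ≤ q := by exact_mod_cast hq1
              linarith
  · filter_upwards [eventually_ge_atTop 1] with n hn i
    refine (hdiam n i).trans ?_
    split_ifs with hi
    · exact bot_le
    · refine ENNReal.ofReal_le_ofReal (h.mul_anti (by positivity) ?_)
      exact_mod_cast (by omega : n ≤ i.1)
  · obtain ⟨q₁, hq₁⟩ := eventually_atTop.1
      (h.tendsto_mul_zero.eventually (eventually_le_nhds (zero_lt_one)))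
    refine Eventually.of_forall fun n => ?_
    rintro x ⟨hx, hxN, hxN', hx0⟩
    have hex : ∃ r : ℤ × ℕ, (0 < r.2 ∧ |x - (r.1 : ℝ) / (r.2 : ℝ)| ≤ Ψ (r.2 : ℝ)) ∧
        n ≤ r.2 ∧ q₀ ≤ r.2 ∧ q₁ ≤ r.2 := by
      by_contra hcon
      push Not at hcon
      -- Each `q` admits finitely many `p`, so infinitely many pairs force arbitrarily large `q`.
      set M := max n (max q₀ q₁)
      refine hx (Set.Finite.subset (s := ⋃ q ∈ Finset.range M, (fun p : ℤ => (p, q)) ''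
        {p : ℤ | 0 < q ∧ |x - (p : ℝ) / (q : ℝ)| ≤ Ψ (q : ℝ)}) ?_ ?_)
      · refine Set.Finite.biUnion (Finset.finite_toSet _) fun q _ => Set.Finite.image _ ?_
        refine (Set.finite_Icc ⌊(q : ℝ) * (x - Ψ q)⌋ ⌈(q : ℝ) * (x + Ψ q)⌉).subset ?_
        rintro p ⟨hq, hp⟩
        have hq' : (0 : ℝ) < q := by exact_mod_cast hq
        rw [abs_le] at hp
        have hpq : (p : ℝ) = q * (p / q) := by field_simp
        constructor
        · have : (q : ℝ) * (x - Ψ q) ≤ p := by rw [hpq]; gcongr; linarith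
          exact_mod_cast (Int.floor_le _).trans this
        · have : (p : ℝ) ≤ (q : ℝ) * (x + Ψ q) := by rw [hpq]; gcongr; linarith
          exact_mod_cast this.trans (Int.le_ceil _)
      · rintro ⟨p, q⟩ hr
        have := hcon (p, q) hr
        simp only [mem_iUnion, Finset.mem_range, exists_prop]
        refine ⟨q, ?_, p, hr, rfl⟩
        by_contra hM
        rw [not_lt] at hM
        have h1 : n ≤ q := le_trans (le_max_left _ _) hM
        have h2 : q₀ ≤ q := le_trans (le_trans (le_max_left _ _) (le_max_right _ _)) hM
        have h3 : q₁ ≤ q := le_trans (le_trans (le_max_right _ _) (le_max_right _ _)) hM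
        exact absurd h3 (by simpa using this h1 h2)
    obtain ⟨⟨p, q⟩, ⟨hq, hp⟩, hn, hq0, hq1⟩ := hex
    simp only at hq hp hn hq0 hq1
    have hq' : (0 : ℝ) < q := by exact_mod_cast hq
    have hlow := hx0 q hq0 p
    have hΨ := hq₁ q hq1
    have hpq : (p : ℝ) = q * (p / q) := by field_simp
    have hp' := abs_le.1 hp
    have hp1 : (N : ℝ) * q - 1 ≤ p := by
      have : (q : ℝ) * (N - Ψ q) ≤ q * (p / q) := by gcongr; linarith
      rw [← hpq] at this
      linarith
    have hp2 : (p : ℝ) ≤ N * q + q + 1 := by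
      have : (q : ℝ) * (p / q) ≤ q * (N + 1 + Ψ q) := by gcongr; linarith
      rw [← hpq] at this
      linarith
    have hp1' : N * q - 1 ≤ p := by exact_mod_cast hp1
    have hp2' : p ≤ N * q + q + 1 := by exact_mod_cast hp2
    obtain ⟨j, hj⟩ := Int.eq_ofNat_of_zero_le (sub_nonneg.2 hp1')
    have hjlt : j < q + 3 := by omega
    have hc : c q ⟨j, hjlt⟩ = p / q := by
      simp only [c]
      congr 2
      omega
    have hnot : ¬ (q < n ∨ q = 0) := by omega
    rw [mem_iUnion]
    rcases le_total (p / q : ℝ) x with hle | hle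
    · refine ⟨⟨q, ⟨j, hjlt⟩, true⟩, ?_⟩
      rw [abs_of_nonneg (by linarith)] at hlow
      simp only [t, hnot, if_false, if_true, hc]
      constructor <;> linarith
    · refine ⟨⟨q, ⟨j, hjlt⟩, false⟩, ?_⟩
      rw [abs_of_nonpos (by linarith)] at hlow
      simp only [t, hnot, if_false, Bool.false_eq_true, hc]
      constructor <;> linarith

lemma not_summable_zero (Ψ ω : ℝ → ℝ) :
    ¬ Summable fun q : ℕ => (q : ℝ) * (Ψ q * ω q) ^ (0 : ℝ) := by
  intro hs
  have := hs.tendsto_atTop_zero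
  simp only [Real.rpow_zero, mul_one] at this
  exact not_tendsto_nhds_of_tendsto_atTop tendsto_natCast_atTop_atTop _ this

lemma dimH_exactSet_le (h : Admissible Ψ ω) : dimH (exactSet Ψ ω) ≤ convergenceExponent Ψ ω := by
  refine le_sInf ?_
  rintro t ⟨s, rfl, hs⟩
  have hs0 : (0 : ℝ) < s := by
    rcases (s.2 : (0 : ℝ) ≤ s).eq_or_lt with h0 | h0
    · have h0' : (s : ℝ) = 0 := h0.symm
      rw [h0'] at hs
      exact absurd hs (not_summable_zero Ψ ω)
    · exact h0
  -- The index from which the lower inequality holds depends on `x`; a countable union makes it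
  -- uniform.
  have hsub : exactSet Ψ ω ⊆ ⋃ (N : ℤ), ⋃ (q₀ : ℕ), {x : ℝ | x ∈ approximableSet Ψ ∧
      (N : ℝ) ≤ x ∧ x ≤ N + 1 ∧
      ∀ q : ℕ, q₀ ≤ q → ∀ p : ℤ, (1 - ω q) * Ψ q ≤ |x - (p : ℝ) / (q : ℝ)|} := by
    rintro x ⟨hx, hx'⟩
    obtain ⟨q₀, hq₀⟩ := eventually_atTop.1 hx'
    simp only [mem_iUnion]
    exact ⟨⌊x⌋, q₀, hx, Int.floor_le x, (Int.lt_floor_add_one x).le, hq₀⟩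
  refine (dimH_mono hsub).trans ?_
  rw [dimH_iUnion]
  refine iSup_le fun N => ?_
  rw [dimH_iUnion]
  exact iSup_le fun q₀ => dimH_le_of_hausdorffMeasure_ne_top
    (h.hausdorffMeasure_exactSet_ne_top hs0 hs N q₀)

end Admissible

/-! ### Remote rationals and the arithmetic of contact intervals -/

/-- Beyond the index `Q` all asymptotic hypotheses hold with explicit constants. -/
structure IsThreshold (Ψ ω : ℝ → ℝ) (Q : ℕ) : Prop where
  pos : 0 < Q
  sq_mul_le : ∀ q : ℕ, Q ≤ q → (q : ℝ) ^ 2 * Ψ q ≤ 1 / 100000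
  omega_le : ∀ q : ℕ, Q ≤ q → ω q ≤ 1 / 12
  ge : ∀ q : ℕ, Q ≤ q → 45 / (16 * Ψ q) * Ψ (1 / (8 * Ψ q)) ≤ ω q
  tail : ∀ F : Finset ℕ, (∀ j ∈ F, Q < 2 ^ (j + 1)) → ∑ j ∈ F, 4 ^ j * Ψ (2 ^ j) ≤ 1 / 20000

/-- The rational `w` of denominator `d` is far, in comparison with `d ^ 2 * Ψ d`, from all rationals
of smaller denominator. -/
def IsRemote (Ψ : ℝ → ℝ) (w : ℚ) : Prop :=
  ∀ v : ℚ, v.den < w.den → 44 * ((w.den : ℝ) ^ 2 * Ψ w.den) / (v.den : ℝ) ^ 2 ≤ |(w : ℝ) - v|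

/-- The points to the right of `w` whose distance to `w` lies between `(1 - ω d) * Ψ d` and `Ψ d`,
where `d` is the denominator of `w`. -/
def contactInterval (Ψ ω : ℝ → ℝ) (w : ℚ) : Set ℝ :=
  Icc ((w : ℝ) + Ψ w.den - Ψ w.den * ω w.den) (w + Ψ w.den)

lemma Rat.cast_den_pos (v : ℚ) : (0 : ℝ) < v.den := by exact_mod_cast v.den_pos

lemma Rat.cast_eq_num_div_den (v : ℚ) : (v : ℝ) = v.num / v.den := Rat.cast_def v

lemma Rat.inv_den_mul_den_le {u v : ℚ} (huv : u ≠ v) :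
    1 / ((u.den : ℝ) * v.den) ≤ |(u : ℝ) - v| := by
  have hu := u.cast_den_pos
  have hv := v.cast_den_pos
  have hne : u.num * v.den - v.num * u.den ≠ 0 := by
    intro h0
    apply huv
    rw [← Rat.num_div_den u, ← Rat.num_div_den v, div_eq_div_iff (by positivity) (by positivity)]
    exact_mod_cast sub_eq_zero.1 h0
  have h1 : (1 : ℝ) ≤ |(u.num : ℝ) * v.den - v.num * u.den| := by
    exact_mod_cast Int.one_le_abs hne
  have heq : (u : ℝ) - v = ((u.num : ℝ) * v.den - v.num * u.den) / (u.den * v.den) := by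
    rw [u.cast_eq_num_div_den, v.cast_eq_num_div_den]; field_simp
  rw [heq, abs_div, abs_of_pos (_root_.mul_pos hu hv)]
  gcongr

namespace Admissible

variable {Ψ ω : ℝ → ℝ}

/-- Cauchy condensation applies because `q * Ψ q` is nonincreasing, being `q ^ 2 * Ψ q` divided by
`q`. -/
lemma summable_four_pow_mul (h : Admissible Ψ ω) :
    Summable fun k : ℕ => (4 : ℝ) ^ k * Ψ (2 ^ k) := by
  have hcond : Summable fun k : ℕ => (2 : ℝ) ^ k * ((2 ^ k : ℕ) * Ψ (2 ^ k : ℕ)) := by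
    refine (summable_condensed_iff_of_nonneg (f := fun n : ℕ => (n : ℝ) * Ψ n) ?_ ?_).2 h.sum
    · intro n
      rcases Nat.eq_zero_or_pos n with rfl | hn
      · simp
      · have := h.pos n (by positivity)
        positivity
    · intro m n hm hmn
      have hm' : (0 : ℝ) < m := by exact_mod_cast hm
      have hmn' : (m : ℝ) ≤ n := by exact_mod_cast hmn
      have h1 := h.sq_mul_le hm' hmn'
      have h2 := h.pos m hm'
      have h3 : (m : ℝ) * (n * Ψ n) ≤ n * (n * Ψ n) := by
        have := h.pos n (hm'.trans_le hmn')
        gcongr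
      refine le_of_mul_le_mul_left ?_ hm'
      nlinarith
  refine hcond.congr fun k => ?_
  push_cast
  rw [← mul_assoc, ← mul_pow]
  norm_num

lemma exists_sq_mul_le (h : Admissible Ψ ω) {ε : ℝ} (hε : 0 < ε) :
    ∃ k : ℕ, ∀ q : ℝ, 2 ^ k ≤ q → q ^ 2 * Ψ q ≤ ε := by
  obtain ⟨k, hk⟩ := (h.summable_four_pow_mul.tendsto_atTop_zero.eventually
    (eventually_le_nhds hε)).exists
  refine ⟨k, fun q hq => (h.sq_mul_le (by positivity) hq).trans ?_⟩
  rw [← pow_mul, mul_comm k 2, pow_mul]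
  norm_num
  exact hk

lemma tendsto_sq_mul_zero (h : Admissible Ψ ω) :
    Tendsto (fun q : ℝ => q ^ 2 * Ψ q) atTop (𝓝 0) := by
  rw [Metric.tendsto_atTop]
  intro ε hε
  obtain ⟨k, hk⟩ := h.exists_sq_mul_le (half_pos hε)
  refine ⟨2 ^ k, fun q hq => ?_⟩
  have hq0 : 0 < q := lt_of_lt_of_le (by positivity) hq
  have := h.pos q hq0
  rw [Real.dist_eq, sub_zero, abs_of_nonneg (by positivity)]
  linarith [hk q hq]

lemma exists_isThreshold (h : Admissible Ψ ω) : ∃ Q, IsThreshold Ψ ω Q := by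
  obtain ⟨s, hs⟩ := summable_iff_vanishing_norm.1 h.summable_four_pow_mul (1 / 20000) (by norm_num)
  obtain ⟨k, hk⟩ := h.exists_sq_mul_le (show (0 : ℝ) < 1 / 100000 by norm_num)
  have hω := tendsto_natCast_atTop_atTop (R := ℝ) |>.eventually
    (h.lim.eventually (eventually_le_nhds (show (0 : ℝ) < 1 / 12 by norm_num)))
  obtain ⟨q₁, hq₁⟩ := eventually_atTop.1 (hω.and h.ge)
  refine ⟨max (2 ^ k) (max q₁ (2 ^ (s.sup id + 1))), ?_, ?_, ?_, ?_, ?_⟩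
  · exact lt_of_lt_of_le (by positivity) (le_max_left _ _)
  · intro q hq
    have hq' : 2 ^ k ≤ q := (le_max_left _ _).trans hq
    exact hk q (by exact_mod_cast hq')
  · exact fun q hq => (hq₁ q (((le_max_left _ _).trans (le_max_right _ _)).trans hq)).1
  · exact fun q hq => (hq₁ q (((le_max_left _ _).trans (le_max_right _ _)).trans hq)).2
  · intro F hF
    refine (le_abs_self _).trans (hs F ?_).le
    rw [Finset.disjoint_left]
    intro j hj hjs
    have h1 : j ≤ s.sup id := Finset.le_sup (f := id) hjs
    have h2 := hF j hj
    have h3 : 2 ^ (s.sup id + 1) < 2 ^ (j + 1) :=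
      lt_of_le_of_lt ((le_max_right _ _).trans (le_max_right _ _)) h2
    have := (Nat.pow_lt_pow_iff_right (by norm_num)).1 h3
    omega

/-- The relation `hab` says that `a / b - w = t / (d b)`, with `d` the denominator of `w`. If `|b| <
d`, remoteness applies to `a / b`; otherwise `44 ≤ m` is enough. -/
lemma mul_abs_le_of_isRemote (h : Admissible Ψ ω) {w : ℚ} (hw : IsRemote Ψ w) {m : ℝ}
    (hm : (Ψ w.den)⁻¹ = (w.den : ℝ) ^ 2 * m) (hm44 : 44 ≤ m) {a b t : ℤ} (hb : b ≠ 0) (ht : 0 < t)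
    (hab : w.den * a - w.num * b = t) : 44 * (w.den : ℝ) ≤ m * t * |(b : ℝ)| := by
  have hq := w.cast_den_pos
  have hb1 : (0 : ℝ) < |(b : ℝ)| := by positivity
  have ht1 : (1 : ℝ) ≤ t := by exact_mod_cast ht
  rcases lt_or_ge |b| (w.den : ℤ) with hlt | hge
  · have hdvd : (((a / b : ℚ)).den : ℤ) ∣ b := by
      rw [← Rat.divInt_eq_div]; exact Rat.den_dvd a b
    have hle : (((a / b : ℚ)).den : ℤ) ≤ |b| :=
      Int.le_of_dvd (abs_pos.2 hb) ((dvd_abs _ _).2 hdvd)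
    have hle' : ((a / b : ℚ).den : ℝ) ≤ |(b : ℝ)| := by exact_mod_cast hle
    have h1 := hw (a / b : ℚ) (by exact_mod_cast hle.trans_lt hlt)
    have hv := Rat.cast_den_pos (a / b : ℚ)
    have hb' : (b : ℝ) ≠ 0 := by exact_mod_cast hb
    have h2 : |(w : ℝ) - ((a / b : ℚ) : ℝ)| = t / (w.den * |(b : ℝ)|) := by
      rw [w.cast_eq_num_div_den]
      push_cast
      have hab' : (w.den : ℝ) * a - w.num * b = t := by exact_mod_cast hab
      have : (w.num : ℝ) / w.den - a / b = -(t / (w.den * b)) := by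
        rw [← hab']; field_simp; ring
      rw [this, abs_neg, abs_div, abs_mul, abs_of_pos hq, abs_of_pos (show (0 : ℝ) < t by linarith)]
    have h3 : (w.den : ℝ) ^ 2 * Ψ w.den = 1 / m := by
      have := h.pos _ hq
      field_simp at hm ⊢
      linarith
    rw [h2, h3] at h1
    have h4 : 44 * (1 / m) / |(b : ℝ)| ^ 2 ≤ t / (w.den * |(b : ℝ)|) := by
      refine le_trans ?_ h1
      gcongr
    rw [mul_one_div, div_div, div_le_div_iff₀ (by positivity) (by positivity)] at h4
    refine le_of_mul_le_mul_right ?_ hb1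
    linarith
  · have hge' : (w.den : ℝ) ≤ |(b : ℝ)| := by exact_mod_cast hge
    have : 44 * (w.den : ℝ) ≤ m * |(b : ℝ)| := by gcongr
    have h5 : m * |(b : ℝ)| * 1 ≤ m * |(b : ℝ)| * t := by gcongr
    linarith

set_option maxHeartbeats 400000 in
/-- A rational with denominator at least that of a remote `w` and which is very close to the contact
interval of `w` has a small neighbourhood compared with the contact interval. -/
lemma le_of_close_to_contactInterval (h : Admissible Ψ ω) {Q : ℕ} (hQ : IsThreshold Ψ ω Q) {w : ℚ}
    (hwQ : Q ≤ w.den) (hw : IsRemote Ψ w) {v : ℚ} (hvw : v ≠ w) (hden : w.den ≤ v.den) {x : ℝ}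
    (hx : x ∈ contactInterval Ψ ω w) (hxv : |x - v| ≤ 2 * Ψ v.den) :
    20 * Ψ v.den ≤ Ψ w.den * ω w.den := by
  have hq := w.cast_den_pos
  have hi := v.cast_den_pos
  obtain ⟨M, hM⟩ := h.div w.den w.den_pos
  have hΨ := h.pos _ hq
  have hΨi := h.pos _ hi
  have hωq := hQ.omega_le _ hwQ
  have hωpos := (h.omega_mem _ hq).1
  have hden' : (w.den : ℝ) ≤ v.den := by exact_mod_cast hden
  set q : ℝ := (w.den : ℝ) with hqdef
  set i : ℝ := (v.den : ℝ) with hidef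
  set m : ℝ := (M : ℝ) with hmdef
  have hmul : q ^ 2 * m * Ψ q = 1 := by rw [← hM]; exact inv_mul_cancel₀ hΨ.ne'
  have hm : 100000 ≤ m := by
    have h1 := hQ.sq_mul_le _ hwQ
    have h2 : 0 < q ^ 2 * Ψ q := by positivity
    have h3 : 0 < m := by
      by_contra hcon
      nlinarith
    nlinarith
  have hm0 : 0 < m := by linarith
  have hΨeq : Ψ q = 1 / (q ^ 2 * m) := by rw [← hM, one_div, inv_inv]
  have hΨile : Ψ i ≤ 1 / (m * i ^ 2) := by
    have h1 := h.sq_mul_le hq hden'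
    rw [le_div_iff₀ (by positivity)]
    have : m * (i ^ 2 * Ψ i) ≤ m * (q ^ 2 * Ψ q) := by gcongr
    linarith
  obtain ⟨hx1, hx2⟩ := hx
  have hxv' := abs_le.1 hxv
  -- With `q`, `i` the denominators of `w`, `v` and `m = 1 / (q ^ 2 * Ψ q)` an integer, `t` measures
  -- `v - w` and `b` measures the distance from `v` to the right endpoint `w + 1 / (q ^ 2 * m)`.
  set t : ℤ := v.num * w.den - w.num * v.den with htdef
  set b : ℤ := v.den - t * w.den * M with hbdef
  have hvweq : (v : ℝ) - w = t / (q * i) := by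
    rw [v.cast_eq_num_div_den, w.cast_eq_num_div_den, htdef]; push_cast; field_simp
    rw [← hqdef, ← hidef]; ring
  have hbi : (b : ℝ) = i - t * q * m := by rw [hbdef]; push_cast; rfl
  have hvP : (v : ℝ) - (w + Ψ q) = -(b / (i * (q ^ 2 * m))) := by
    have : (v : ℝ) - (w + Ψ q) = t / (q * i) - Ψ q := by linarith
    rw [this, hΨeq, hbi]; field_simp; ring
  -- A nonzero `b` is thus the denominator of a fraction at distance `t / (q |b|)` from `w`, to
  -- which remoteness can be applied.
  have hrel : w.den * (v.num - w.num * t * M) - w.num * b = t := by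
    rw [hbdef, htdef]; ring
  have ht0 : t ≠ 0 := by
    intro h0
    apply hvw
    rw [h0] at hvweq
    simp only [Int.cast_zero, zero_div, sub_eq_zero] at hvweq
    exact_mod_cast hvweq
  have hωΨ : Ψ q * ω q ≤ Ψ q / 12 := by nlinarith
  -- If `t < 0`, then `v` is left of `w` by at least `1 / i ^ 2`, more than `2 * Ψ i`, whereas `x`
  -- is right of `w`.
  rcases lt_or_gt_of_ne ht0 with htneg | htpos
  · exfalso
    have ht1 : (t : ℝ) ≤ -1 := by exact_mod_cast (by omega : t ≤ -1)
    have h1 : (t : ℝ) / (q * i) ≤ -1 / (q * i) := by gcongr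
    have h2 : 1 / i ^ 2 ≤ 1 / (q * i) := by
      rw [sq]; gcongr
    have h3 : 2 * (1 / (m * i ^ 2)) < 1 / i ^ 2 := by
      rw [mul_one_div, div_lt_div_iff₀ (by positivity) (by positivity)]
      linarith [mul_lt_mul_of_pos_right (show 4 < m by linarith) (_root_.mul_pos hi hi),
        _root_.mul_pos hi hi]
    rw [neg_div] at h1
    have h4 : (v : ℝ) = w + t / (q * i) := by linarith
    nlinarith
  · have ht1 : (1 : ℝ) ≤ t := by exact_mod_cast htpos
    -- Here `v` is the endpoint and `i ≥ q ^ 2 * m`, which is 8 times `1 / (8 * Ψ q)`. Hence `64 * Ψ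
    -- i ≤ Ψ (1 / (8 * Ψ q))`, and the lower bound on `ω` concludes.
    by_cases hb : b = 0
    · have hdvd : (w.den : ℤ) ∣ t := ⟨v.num - w.num * t * M, by rw [hb] at hrel; linarith⟩
      have hqt : q ≤ t := by rw [hqdef]; exact_mod_cast Int.le_of_dvd htpos hdvd
      have hieq : i = t * q * m := by rw [hb] at hbi; push_cast at hbi; linarith
      have hiQ : q ^ 2 * m ≤ i := by
        rw [hieq, sq]; gcongr
      have hge := hQ.ge _ hwQ
      rw [← hqdef] at hge
      have h8 : 1 / (8 * Ψ q) = q ^ 2 * m / 8 := by rw [hΨeq]; field_simp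
      rw [h8] at hge
      have h1 := h.sq_mul_le (a := q ^ 2 * m / 8) (b := i) (by positivity) (by linarith [show 0 < q ^ 2 * m by positivity])
      have h2 : (q ^ 2 * m) ^ 2 * Ψ i ≤ i ^ 2 * Ψ i := by gcongr
      have h3 : 64 * Ψ i ≤ Ψ (q ^ 2 * m / 8) := by
        refine le_of_mul_le_mul_left ?_ (show 0 < (q ^ 2 * m) ^ 2 by positivity)
        linarith
      have h4 : 45 / (16 * Ψ q) * Ψ (q ^ 2 * m / 8) * Ψ q ≤ ω q * Ψ q := by gcongr
      have h5 : 45 / (16 * Ψ q) * Ψ (q ^ 2 * m / 8) * Ψ q = 45 / 16 * Ψ (q ^ 2 * m / 8) := by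
        field_simp
      linarith
    · have hkey := h.mul_abs_le_of_isRemote hw hM (by linarith) hb htpos hrel
      have habs : |(v : ℝ) - (w + Ψ q)| = |(b : ℝ)| / (i * (q ^ 2 * m)) := by
        rw [hvP, abs_neg, abs_div, abs_of_pos (show 0 < i * (q ^ 2 * m) by positivity)]
      have hupper : |(v : ℝ) - (w + Ψ q)| ≤ Ψ q * ω q + 2 * Ψ i := by
        rw [abs_le]; constructor <;> linarith
      -- For small `|b|` one has `i ≥ t q m / 2`, so `v` is at least `(44 / 2) * Ψ i` from the
      -- endpoint; subtracting `2 * Ψ i` leaves the 20 of the conclusion. For large `|b|`, `v` is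
      -- too far from the contact interval on either side.
      rcases le_or_gt |(b : ℝ)| (t * q * m / 2) with hbs | hbl
      · have hlow : t * q * m / 2 ≤ i := by have := neg_le_of_abs_le hbs; linarith
        have h1 : 22 * Ψ i ≤ |(b : ℝ)| / (i * (q ^ 2 * m)) := by
          rw [le_div_iff₀ (by positivity)]
          have hA : Ψ i * (m * i ^ 2) ≤ 1 := by
            rwa [le_div_iff₀ (by positivity)] at hΨile
          have hB : 44 * q * (t * q * m / 2) ≤ (m * t * |(b : ℝ)|) * i := by gcongr
          have hB' : 22 * q ^ 2 ≤ |(b : ℝ)| * i := by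
            refine le_of_mul_le_mul_left ?_ (show 0 < m * t by positivity)
            linarith
          refine le_of_mul_le_mul_right ?_ hi
          have : 22 * q ^ 2 * (Ψ i * (m * i ^ 2)) ≤ 22 * q ^ 2 * 1 := by gcongr
          linarith
        rw [habs] at hupper
        linarith
      · exfalso
        rcases lt_or_gt_of_ne hb with hbneg | hbpos
        · have hbneg' : (b : ℝ) < 0 := by exact_mod_cast hbneg
          rw [abs_of_neg hbneg'] at hbl
          have hi2 : i < t * q * m / 2 := by linarith
          have h1 : 1 / (2 * i ^ 2) ≤ -(b / (i * (q ^ 2 * m))) := by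
            rw [← neg_div, div_le_div_iff₀ (by positivity) (by positivity)]
            have h2 : q * m / 2 ≤ -(b : ℝ) := by
              have : 1 * (q * m / 2) ≤ t * (q * m / 2) := by gcongr
              linarith
            have h3 : (q * m / 2) * (2 * i ^ 2) ≤ -(b : ℝ) * (2 * i ^ 2) := by gcongr
            have h4 : q * i * (q * m) ≤ i * i * (q * m) := by gcongr
            linarith
          have h3 : 2 * (1 / (m * i ^ 2)) < 1 / (2 * i ^ 2) := by
            rw [mul_one_div, div_lt_div_iff₀ (by positivity) (by positivity)]
            linarith [mul_lt_mul_of_pos_right (show 4 < m by linarith) (_root_.mul_pos hi hi),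
        _root_.mul_pos hi hi]
          linarith
        · have hbpos' : (0 : ℝ) < b := by exact_mod_cast hbpos
          rw [abs_of_pos hbpos'] at hbl
          have h1 : Ψ q / 3 ≤ b / (i * (q ^ 2 * m)) := by
            rw [hΨeq, div_div, div_le_div_iff₀ (by positivity) (by positivity)]
            have : i ≤ 3 * b := by linarith
            have : i * (q ^ 2 * m) ≤ 3 * b * (q ^ 2 * m) := by gcongr
            linarith
          have hiqm : q * m ≤ i := by
            have : 1 * (q * m) ≤ t * (q * m) := by gcongr
            linarith
          have h2 : 1 / (m * i ^ 2) ≤ Ψ q / 100 := by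
            rw [hΨeq, div_div, div_le_div_iff₀ (by positivity) (by positivity)]
            have h3 : m * (q * m) ^ 2 ≤ m * i ^ 2 := by gcongr
            have h4 : q ^ 2 * m * 100 ≤ q ^ 2 * m * m ^ 2 := by
              have : (100 : ℝ) ≤ m ^ 2 := by nlinarith
              gcongr
            linarith
          linarith

end Admissible

/-! ### Counting rationals and measuring unions of balls about them -/

lemma card_le_of_separated {F : Finset ℝ} {a l δ : ℝ} (hδ : 0 < δ) (hl : 0 ≤ l)
    (hF : ∀ x ∈ F, x ∈ Icc a (a + l)) (hsep : ∀ x ∈ F, ∀ y ∈ F, x ≠ y → δ ≤ |x - y|) :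
    (F.card : ℝ) ≤ l / δ + 1 := by
  have hmaps : ∀ x ∈ F, ⌊(x - a) / δ⌋₊ ∈ Finset.range (⌊l / δ⌋₊ + 1) := by
    intro x hx
    have := (hF x hx).2
    rw [Finset.mem_range, Nat.lt_succ_iff]
    refine Nat.floor_le_floor ?_
    gcongr
    linarith
  have hinj : ∀ x ∈ F, ∀ y ∈ F, ⌊(x - a) / δ⌋₊ = ⌊(y - a) / δ⌋₊ → x = y := by
    intro x hx y hy hxy
    by_contra hne
    have h1 := hsep x hx y hy hne
    have hx0 : 0 ≤ (x - a) / δ := div_nonneg (sub_nonneg.2 (hF x hx).1) hδ.le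
    have hy0 : 0 ≤ (y - a) / δ := div_nonneg (sub_nonneg.2 (hF y hy).1) hδ.le
    have h2 := Nat.floor_le hx0
    have h3 := Nat.lt_floor_add_one ((x - a) / δ)
    have h4 := Nat.floor_le hy0
    have h5 := Nat.lt_floor_add_one ((y - a) / δ)
    rw [hxy] at h2 h3
    have h6 : |(x - a) / δ - (y - a) / δ| < 1 := by
      rw [abs_lt]; constructor <;> linarith
    rw [← sub_div, abs_div, abs_of_pos hδ, div_lt_one hδ] at h6
    have : x - a - (y - a) = x - y := by ring
    rw [this] at h6
    linarith
  have hcard := Finset.card_le_card_of_injOn _ hmaps hinj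
  rw [Finset.card_range] at hcard
  calc (F.card : ℝ) ≤ ((⌊l / δ⌋₊ + 1 : ℕ) : ℝ) := by exact_mod_cast hcard
    _ ≤ l / δ + 1 := by
      push_cast
      gcongr
      exact Nat.floor_le (by positivity)

lemma Rat.inv_sq_le_abs_sub {u v : ℚ} (huv : u ≠ v) {D : ℝ} (hu : (u.den : ℝ) ≤ D)
    (hv : (v.den : ℝ) ≤ D) : 1 / D ^ 2 ≤ |(u : ℝ) - v| := by
  refine le_trans ?_ (Rat.inv_den_mul_den_le huv)
  have := u.cast_den_pos
  have := v.cast_den_pos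
  rw [sq]
  gcongr
  linarith

lemma Rat.finite_den_le (a b : ℝ) (D : ℕ) :
    {v : ℚ | v.den ≤ D ∧ (v : ℝ) ∈ Icc a b}.Finite := by
  refine Set.Finite.of_finite_image (f := fun v : ℚ => (v.num, v.den)) ?_ ?_
  · refine ((Set.finite_Icc (-⌈D * (|a| + |b|)⌉) ⌈D * (|a| + |b|)⌉).prod
      (Set.finite_Iic D)).subset ?_
    rintro _ ⟨v, ⟨hv, hva, hvb⟩, rfl⟩
    have hd := v.cast_den_pos
    have hD : (v.den : ℝ) ≤ D := by exact_mod_cast hv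
    have hnum : (v.num : ℝ) = v.den * v := by rw [v.cast_eq_num_div_den]; field_simp
    have h1 : |(v : ℝ)| ≤ |a| + |b| := by
      rw [abs_le]
      constructor
      · linarith [neg_abs_le a, abs_nonneg b]
      · linarith [le_abs_self b, abs_nonneg a]
    have h2 : |(v.num : ℝ)| ≤ D * (|a| + |b|) := by
      rw [hnum, abs_mul, abs_of_pos hd]
      gcongr
    have h3 := abs_le.1 (h2.trans (Int.le_ceil _))
    refine ⟨⟨?_, ?_⟩, hv⟩
    · exact_mod_cast h3.1
    · exact_mod_cast h3.2
  · intro u _ v _ huv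
    simp only [Prod.mk.injEq] at huv
    exact Rat.ext huv.1 huv.2

lemma Rat.card_le_of_den_le {F : Finset ℚ} {a l D : ℝ} (hD : 0 < D) (hl : 0 ≤ l)
    (hF : ∀ v ∈ F, (v : ℝ) ∈ Icc a (a + l)) (hden : ∀ v ∈ F, (v.den : ℝ) ≤ D) :
    (F.card : ℝ) ≤ D ^ 2 * l + 1 := by
  classical
  have hcard : (F.image fun v : ℚ => (v : ℝ)).card = F.card :=
    Finset.card_image_of_injective _ Rat.cast_injective
  have := card_le_of_separated (F := F.image fun v : ℚ => (v : ℝ)) (a := a) (l := l)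
    (δ := 1 / D ^ 2) (by positivity) hl ?_ ?_
  · rw [hcard] at this
    refine this.trans (le_of_eq ?_)
    field_simp
  · simpa using hF
  · intro x hx y hy hxy
    simp only [Finset.mem_image] at hx hy
    obtain ⟨u, hu, rfl⟩ := hx
    obtain ⟨v, hv, rfl⟩ := hy
    exact Rat.inv_sq_le_abs_sub (fun h => hxy (by rw [h])) (hden u hu) (hden v hv)

namespace Admissible

variable {Ψ ω : ℝ → ℝ}

open MeasureTheory

/-- Denominators are grouped dyadically. Apart from one `v₀` of least denominator, which costs `2 *
r`, a nonempty class contains a point distinct from `v₀`; two rationals of denominator below `2 ^ (j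
+ 1)` then lie in the interval, so `4 * 4 ^ j * l ≥ 1`, which absorbs the `+ 1` of the counting
bound. The condensed series controls the sum. -/
lemma volume_iUnion_closedBall_le (h : Admissible Ψ ω) {Q : ℕ} (hQ : IsThreshold Ψ ω Q) {S : Set ℚ}
    {a l r K : ℝ} (hl : 0 ≤ l) (hr : 0 ≤ r) (hK : 0 ≤ K) (hS : ∀ v ∈ S, (v : ℝ) ∈ Icc a (a + l))
    (hSQ : ∀ v ∈ S, Q ≤ v.den) {ρ : ℚ → ℝ} (hρr : ∀ v ∈ S, ρ v ≤ r)
    (hρ : ∀ v ∈ S, ρ v ≤ K * Ψ v.den) :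
    volume (⋃ v ∈ S, Metric.closedBall (v : ℝ) (ρ v)) ≤
      ENNReal.ofReal (2 * r + 16 * K * l / 20000) := by
  classical
  rcases S.eq_empty_or_nonempty with rfl | hne
  · simp
  obtain ⟨v₀, hv₀, hmin⟩ : ∃ v₀ ∈ S, ∀ v ∈ S, v₀.den ≤ v.den := by
    have hex : ∃ n, ∃ v ∈ S, v.den = n := ⟨_, hne.some, hne.some_mem, rfl⟩
    obtain ⟨v₀, hv₀, hd⟩ := Nat.find_spec hex
    exact ⟨v₀, hv₀, fun v hv => hd ▸ Nat.find_min' hex ⟨v, hv, rfl⟩⟩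
  let T : ℕ → Set ℚ := fun j => {v | v ∈ S ∧ v ≠ v₀ ∧ Nat.log 2 v.den = j}
  have hTlow : ∀ j, ∀ v ∈ T j, (2 : ℝ) ^ j ≤ v.den := by
    rintro j v ⟨-, -, rfl⟩
    exact_mod_cast Nat.pow_log_le_self 2 v.den_nz
  have hTup : ∀ j, ∀ v ∈ T j, v.den < 2 ^ (j + 1) := by
    rintro j v ⟨-, -, rfl⟩
    exact Nat.lt_pow_succ_log_self (by norm_num) _
  have hfin : ∀ j, (T j).Finite := fun j =>
    (Rat.finite_den_le a (a + l) (2 ^ (j + 1))).subset fun v hv => ⟨(hTup j v hv).le, hS v hv.1⟩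
  have hTvol : ∀ j, volume (⋃ v ∈ T j, Metric.closedBall (v : ℝ) (ρ v)) ≤
      if Q < 2 ^ (j + 1) then ENNReal.ofReal (16 * K * l * (4 ^ j * Ψ (2 ^ j))) else 0 := by
    intro j
    rcases (T j).eq_empty_or_nonempty with hemp | ⟨v₁, hv₁⟩
    · simp [hemp]
    have hΨj := h.pos (2 ^ j) (by positivity)
    rw [if_pos ((hSQ v₁ hv₁.1).trans_lt (hTup j v₁ hv₁))]
    have hlarge : 1 ≤ 4 * 4 ^ j * l := by
      have h1 := Rat.inv_sq_le_abs_sub hv₁.2.1 (D := 2 ^ (j + 1))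
        (by exact_mod_cast (hTup j v₁ hv₁).le)
        (by exact_mod_cast ((hmin v₁ hv₁.1).trans (hTup j v₁ hv₁).le))
      have h2 : |(v₁ : ℝ) - v₀| ≤ l := by
        have := hS v₁ hv₁.1
        have := hS v₀ hv₀
        simp only [mem_Icc] at *
        rw [abs_le]; constructor <;> linarith
      have h3 := h1.trans h2
      rw [div_le_iff₀ (by positivity)] at h3
      have h4 : ((2 : ℝ) ^ (j + 1)) ^ 2 = 4 * 4 ^ j := by
        rw [← pow_mul, mul_comm, pow_mul]; norm_num [pow_succ]; ring
      rw [h4] at h3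
      linarith
    have hcard : ((hfin j).toFinset.card : ℝ) ≤ 8 * 4 ^ j * l := by
      have h1 := Rat.card_le_of_den_le (F := (hfin j).toFinset) (a := a) (l := l)
        (D := 2 ^ (j + 1)) (by positivity) hl (fun v hv => hS v ((hfin j).mem_toFinset.1 hv).1)
        (fun v hv => by exact_mod_cast (hTup j v ((hfin j).mem_toFinset.1 hv)).le)
      have h4 : ((2 : ℝ) ^ (j + 1)) ^ 2 = 4 * 4 ^ j := by
        rw [← pow_mul, mul_comm, pow_mul]; norm_num [pow_succ]; ring
      rw [h4] at h1
      linarith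
    calc volume (⋃ v ∈ T j, Metric.closedBall (v : ℝ) (ρ v))
        = volume (⋃ v ∈ (hfin j).toFinset, Metric.closedBall (v : ℝ) (ρ v)) := by
          simp only [Set.Finite.mem_toFinset]
      _ ≤ ∑ v ∈ (hfin j).toFinset, volume (Metric.closedBall (v : ℝ) (ρ v)) :=
          measure_biUnion_finset_le _ _
      _ ≤ ∑ v ∈ (hfin j).toFinset, ENNReal.ofReal (2 * (K * Ψ (2 ^ j))) := by
          refine Finset.sum_le_sum fun v hv => ?_
          have hv' := (hfin j).mem_toFinset.1 hv
          rw [Real.volume_closedBall]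
          refine ENNReal.ofReal_le_ofReal ?_
          have h1 := hρ v hv'.1
          have h2 : K * Ψ v.den ≤ K * Ψ (2 ^ j) :=
            mul_le_mul_of_nonneg_left (h.le (by positivity) (hTlow j v hv')) hK
          linarith
      _ = ENNReal.ofReal ((hfin j).toFinset.card * (2 * (K * Ψ (2 ^ j)))) := by
          rw [Finset.sum_const, nsmul_eq_mul, ← ENNReal.ofReal_natCast,
            ← ENNReal.ofReal_mul (by positivity)]
      _ ≤ _ := by
          refine ENNReal.ofReal_le_ofReal ?_
          calc ((hfin j).toFinset.card : ℝ) * (2 * (K * Ψ (2 ^ j)))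
              ≤ (8 * 4 ^ j * l) * (2 * (K * Ψ (2 ^ j))) := by gcongr
            _ = _ := by ring
  have hsub : (⋃ v ∈ S, Metric.closedBall (v : ℝ) (ρ v)) ⊆
      Metric.closedBall (v₀ : ℝ) (ρ v₀) ∪ ⋃ j, ⋃ v ∈ T j, Metric.closedBall (v : ℝ) (ρ v) := by
    refine iUnion₂_subset fun v hv => ?_
    by_cases hvv : v = v₀
    · rw [hvv]; exact subset_union_left
    · refine subset_union_of_subset_right ?_ _
      exact (subset_iUnion₂ (s := fun (u : ℚ) (_ : u ∈ T (Nat.log 2 v.den)) =>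
        Metric.closedBall (u : ℝ) (ρ u)) v ⟨hv, hvv, rfl⟩).trans
        (subset_iUnion (fun j => ⋃ v ∈ T j, Metric.closedBall (v : ℝ) (ρ v)) _)
  refine (measure_mono hsub).trans ((measure_union_le _ _).trans ?_)
  rw [ENNReal.ofReal_add (by positivity) (by positivity)]
  refine add_le_add ?_ ((measure_iUnion_le _).trans ?_)
  · rw [Real.volume_closedBall]
    refine ENNReal.ofReal_le_ofReal ?_
    linarith [hρr v₀ hv₀]
  · refine (ENNReal.tsum_le_tsum hTvol).trans (ENNReal.tsum_le_of_sum_range_le fun n => ?_)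
    rw [← Finset.sum_filter, ← ENNReal.ofReal_sum_of_nonneg, ← Finset.mul_sum]
    · refine ENNReal.ofReal_le_ofReal ?_
      have := hQ.tail ((Finset.range n).filter fun j => Q < 2 ^ (j + 1))
        (fun j hj => (Finset.mem_filter.1 hj).2)
      calc _ ≤ 16 * K * l * (1 / 20000) := by gcongr
        _ = _ := by ring
    · intro j _
      have := h.pos (2 ^ j) (by positivity)
      positivity

end Admissible

/-! ### Dirichlet approximation with large denominators -/

/-- For large `X` most points of an interval are approximated to within `40 / X ^ 2` by rationals with
denominator comparable to `X`. -/
lemma eventually_volume_not_approximable_le {a l : ℝ} (hl : 0 < l) :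
    ∀ᶠ X : ℕ in atTop, MeasureTheory.volume {x ∈ Icc a (a + l) |
      ¬ ∃ w : ℚ, (X : ℝ) / 40 ≤ w.den ∧ w.den ≤ X ∧ |x - w| ≤ 40 / (X : ℝ) ^ 2} ≤
        ENNReal.ofReal (l / 10) := by
  -- The harmonic sum up to `X` is `o(X)`, as a Cesàro mean of a null sequence.
  have hces : Tendsto (fun n : ℕ => (n : ℝ)⁻¹ * ∑ i ∈ Finset.range n, (1 / ((i : ℝ) + 1)))
      atTop (𝓝 0) := tendsto_one_div_add_atTop_nhds_zero_nat.cesaro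
  filter_upwards [hces.eventually (eventually_le_nhds (show 0 < l / 1000 by positivity)),
    eventually_ge_atTop 1] with X hX hX1
  have hX0 : (0 : ℝ) < X := by exact_mod_cast hX1
  have hX1' : (1 : ℝ) ≤ X := by exact_mod_cast hX1
  set M := ⌊(X : ℝ) / 40⌋₊ with hM
  have hMX : M ≤ X := by
    rw [hM]
    refine Nat.floor_le_of_le ?_
    linarith
  have hM40 : (M : ℝ) ≤ X / 40 := Nat.floor_le (by positivity)
  let c : ℕ → ℕ → ℝ := fun d j => ((⌊(d : ℝ) * a⌋ - 1 + j : ℤ) : ℝ) / d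
  have hsub : {x ∈ Icc a (a + l) |
      ¬ ∃ w : ℚ, (X : ℝ) / 40 ≤ w.den ∧ w.den ≤ X ∧ |x - w| ≤ 40 / (X : ℝ) ^ 2} ⊆
      ⋃ e ∈ Finset.range M, ⋃ j ∈ Finset.range (⌊((e : ℝ) + 1) * l⌋₊ + 5),
        Metric.closedBall (c (e + 1) j) (1 / ((X : ℝ) * (e + 1))) := by
    rintro x ⟨⟨hx1, hx2⟩, hx⟩
    obtain ⟨w, hw, hwX⟩ := Real.exists_rat_abs_sub_le_and_den_le x hX1
    have hd := w.cast_den_pos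
    have hw' : |x - w| ≤ 1 / (X * w.den) := by
      refine hw.trans ?_
      gcongr
      linarith
    have hwlt : (w.den : ℝ) < X / 40 := by
      by_contra hcon
      rw [not_lt] at hcon
      refine hx ⟨w, hcon, hwX, hw'.trans ?_⟩
      calc 1 / (X * (w.den : ℝ)) ≤ 1 / (X * (X / 40)) := by gcongr
        _ = 40 / (X : ℝ) ^ 2 := by field_simp
    obtain ⟨e, he⟩ : ∃ e, w.den = e + 1 := ⟨w.den - 1, by have := w.den_pos; omega⟩
    have heM : e < M := by
      have : w.den ≤ M := Nat.le_floor hwlt.le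
      omega
    have hnum : (w.num : ℝ) = w.den * w := by rw [w.cast_eq_num_div_den]; field_simp
    have hwabs := abs_le.1 hw'
    have hone : (w.den : ℝ) * (1 / (X * w.den)) ≤ 1 := by
      rw [mul_one_div, div_le_one (by positivity)]
      nlinarith
    have h1 : (w.den : ℝ) * a - 1 ≤ w.num := by
      rw [hnum]
      have : (w.den : ℝ) * (a - 1 / (X * w.den)) ≤ w.den * w := by gcongr; linarith
      linarith
    have h2 : (w.num : ℝ) ≤ w.den * a + w.den * l + 1 := by
      rw [hnum]
      have : (w.den : ℝ) * w ≤ w.den * (a + l + 1 / (X * w.den)) := by gcongr; linarith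
      linarith
    have h3 : ⌊(w.den : ℝ) * a⌋ - 1 ≤ w.num := by
      have := Int.floor_le ((w.den : ℝ) * a)
      have : ((⌊(w.den : ℝ) * a⌋ - 1 : ℤ) : ℝ) ≤ w.num := by push_cast; linarith
      exact_mod_cast this
    obtain ⟨j, hj⟩ := Int.eq_ofNat_of_zero_le (sub_nonneg.2 h3)
    have hjcast : (j : ℝ) = w.num - (⌊(w.den : ℝ) * a⌋ - 1) := by
      have : (j : ℤ) = w.num - (⌊(w.den : ℝ) * a⌋ - 1) := by simpa using hj.symm
      exact_mod_cast congrArg (Int.cast : ℤ → ℝ) this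
    have hjlt : j < ⌊((e : ℝ) + 1) * l⌋₊ + 5 := by
      have hfl := Int.lt_floor_add_one ((w.den : ℝ) * a)
      have hfl' := Nat.lt_floor_add_one (((e : ℝ) + 1) * l)
      have hed : (w.den : ℝ) = e + 1 := by rw [he]; push_cast; ring
      rw [hed] at h2 hjcast hfl
      have : (j : ℝ) < ((⌊((e : ℝ) + 1) * l⌋₊ + 5 : ℕ) : ℝ) := by push_cast; linarith
      exact_mod_cast this
    simp only [mem_iUnion, Finset.mem_range, exists_prop]
    refine ⟨e, heM, j, hjlt, ?_⟩
    have hc : c (e + 1) j = w := by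
      simp only [c]
      rw [← he, w.cast_eq_num_div_den]
      congr 2
      have : (j : ℤ) = w.num - (⌊(w.den : ℝ) * a⌋ - 1) := by simpa using hj.symm
      rw [this]; ring
    rw [hc, Metric.mem_closedBall, Real.dist_eq]
    rw [he] at hw'
    push_cast at hw'
    exact hw'
  refine (MeasureTheory.measure_mono hsub).trans ?_
  calc _ ≤ ∑ e ∈ Finset.range M, ∑ j ∈ Finset.range (⌊((e : ℝ) + 1) * l⌋₊ + 5),
        MeasureTheory.volume (Metric.closedBall (c (e + 1) j) (1 / ((X : ℝ) * (e + 1)))) :=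
      (MeasureTheory.measure_biUnion_finset_le _ _).trans
        (Finset.sum_le_sum fun e _ => MeasureTheory.measure_biUnion_finset_le _ _)
    -- Denominator `e + 1` contributes at most `(e + 1) * l + 5` intervals of length `2 / (X * (e +
    -- 1))`.
    _ ≤ ∑ e ∈ Finset.range M, ENNReal.ofReal (2 * l / X + 10 / X * (1 / ((e : ℝ) + 1))) := by
      refine Finset.sum_le_sum fun e _ => ?_
      simp only [Real.volume_closedBall]
      rw [Finset.sum_const, Finset.card_range, nsmul_eq_mul, ← ENNReal.ofReal_natCast,
        ← ENNReal.ofReal_mul (by positivity)]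
      refine ENNReal.ofReal_le_ofReal ?_
      push_cast
      have hfl := Nat.floor_le (show 0 ≤ ((e : ℝ) + 1) * l by positivity)
      calc ((⌊((e : ℝ) + 1) * l⌋₊ : ℝ) + 5) * (2 * (1 / (X * (e + 1))))
          ≤ (((e : ℝ) + 1) * l + 5) * (2 * (1 / (X * (e + 1)))) := by gcongr
        _ = _ := by field_simp; ring
    _ = ENNReal.ofReal (∑ e ∈ Finset.range M, (2 * l / X + 10 / X * (1 / ((e : ℝ) + 1)))) := by
      rw [ENNReal.ofReal_sum_of_nonneg]
      intro e _
      positivity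
    _ ≤ _ := by
      refine ENNReal.ofReal_le_ofReal ?_
      rw [Finset.sum_add_distrib, Finset.sum_const, Finset.card_range, nsmul_eq_mul, ← Finset.mul_sum]
      have h1 : (M : ℝ) * (2 * l / X) ≤ X / 40 * (2 * l / X) := by gcongr
      have h2 : (X : ℝ) / 40 * (2 * l / X) = l / 20 := by field_simp; norm_num
      have h3 : ∑ e ∈ Finset.range M, (1 / ((e : ℝ) + 1)) ≤
          ∑ e ∈ Finset.range X, (1 / ((e : ℝ) + 1)) := by
        refine Finset.sum_le_sum_of_subset_of_nonneg (Finset.range_mono hMX) fun e _ _ => ?_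
        positivity
      have h4 : 10 / (X : ℝ) * ∑ e ∈ Finset.range M, (1 / ((e : ℝ) + 1)) ≤
          10 * ((X : ℝ)⁻¹ * ∑ e ∈ Finset.range X, (1 / ((e : ℝ) + 1))) := by
        rw [div_eq_mul_inv, mul_assoc]
        gcongr
      linarith

/-! ### Children of a remote rational, and a first remote rational -/

namespace Admissible

variable {Ψ ω : ℝ → ℝ}

open MeasureTheory

lemma abs_sub_le_of_mem_contactInterval (h : Admissible Ψ ω) {w : ℚ} {x : ℝ}
    (hx : x ∈ contactInterval Ψ ω w) : |x - w| ≤ Ψ w.den := by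
  obtain ⟨h1, h2⟩ := hx
  have := h.mul_le w.cast_den_pos
  have := h.pos _ w.cast_den_pos
  rw [abs_le]; constructor <;> linarith

lemma le_abs_sub_of_isRemote (h : Admissible Ψ ω) {w v : ℚ} (hw : IsRemote Ψ w)
    (hv : v.den < w.den) {x : ℝ} (hx : x ∈ contactInterval Ψ ω w) : Ψ w.den ≤ |x - v| := by
  have h1 := hw v hv
  have hd := v.cast_den_pos
  have hΨ := h.pos _ w.cast_den_pos
  have h2 : 44 * Ψ w.den ≤ 44 * ((w.den : ℝ) ^ 2 * Ψ w.den) / (v.den : ℝ) ^ 2 := by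
    rw [le_div_iff₀ (by positivity)]
    have : (v.den : ℝ) ≤ w.den := by exact_mod_cast hv.le
    have : (v.den : ℝ) ^ 2 * Ψ w.den ≤ (w.den : ℝ) ^ 2 * Ψ w.den := by gcongr
    linarith
  have h3 := abs_sub_abs_le_abs_sub ((w : ℝ) - v) ((w : ℝ) - x)
  have h4 := h.abs_sub_le_of_mem_contactInterval hx
  rw [abs_sub_comm (w : ℝ) x] at h3
  have : (w : ℝ) - v - (w - x) = x - v := by ring
  rw [this] at h3
  linarith

set_option maxHeartbeats 1000000 in
/-- For all large `X`, a positive proportion of the rationals in the contact interval of `w` with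
denominator of size about `X` are remote, have their contact interval inside that of `w`, and the
points of their contact interval are not too close to rationals with intermediate denominators. -/
lemma eventually_exists_children (h : Admissible Ψ ω) {Q : ℕ} (hQ : IsThreshold Ψ ω Q) {w : ℚ}
    (hwQ : Q ≤ w.den) (hw : IsRemote Ψ w) :
    ∀ᶠ X : ℕ in atTop, ∃ F : Finset ℚ, (X : ℝ) ^ 2 * (Ψ w.den * ω w.den) / 160 ≤ F.card ∧
      ∀ u ∈ F, (X : ℝ) / 40 ≤ u.den ∧ u.den ≤ X ∧ w.den < u.den ∧ IsRemote Ψ u ∧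
        contactInterval Ψ ω u ⊆ contactInterval Ψ ω w ∧ (u : ℝ) ∈ contactInterval Ψ ω w ∧
        ∀ x ∈ contactInterval Ψ ω u, ∀ v : ℚ, w.den ≤ v.den → v.den < u.den →
          (1 - ω v.den) * Ψ v.den ≤ |x - v| := by
  classical
  have hq := w.cast_den_pos
  have hΨ := h.pos _ hq
  have hωq := hQ.omega_le _ hwQ
  have hfpos := h.mul_pos hq
  set f : ℝ := Ψ w.den * ω w.den with hf
  have hfΨ : f ≤ Ψ w.den / 2 := by rw [hf]; nlinarith
  set a : ℝ := (w : ℝ) + Ψ w.den - f with ha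
  have hI : contactInterval Ψ ω w = Icc a (a + f) := by
    rw [contactInterval, ← hf, ← ha]; congr 1; linarith
  obtain ⟨T, hT1, hT2⟩ : ∃ T : ℕ, 45 * Ψ T ≤ f / 10 ∧ w.den < T := by
    have h1 := h.tendsto_zero.eventually (eventually_le_nhds (show 0 < f / 450 by positivity))
    obtain ⟨T, hT, hT'⟩ := (h1.and (eventually_gt_atTop w.den)).exists
    exact ⟨T, by linarith, hT'⟩
  have hT0 : (0 : ℝ) < T := hq.trans (by exact_mod_cast hT2)
  have hΨT := h.pos T hT0
  have hΨTq : Ψ T ≤ Ψ w.den := h.le hq (by exact_mod_cast hT2.le)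
  -- Below `T` the radius `2 * Ψ` is all that closeness to the contact interval permits; from `T`
  -- on, the radius 45 leaves 44 for the remoteness of the children after moving from `y` to `u`.
  let ρ : ℚ → ℝ := fun v => if v.den < T then 2 * Ψ v.den else 45 * Ψ v.den
  let S : Set ℚ := {v | v ≠ w ∧ w.den ≤ v.den ∧ ∃ x ∈ contactInterval Ψ ω w, |x - v| ≤ ρ v}
  have hSρ : ∀ v ∈ S, ρ v ≤ f / 10 := by
    rintro v ⟨hvw, hden, x, hx, hxv⟩
    by_cases hvT : v.den < T
    · simp only [ρ, hvT, if_true] at hxv ⊢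
      linarith [h.le_of_close_to_contactInterval hQ hwQ hw hvw hden hx hxv]
    · simp only [ρ, hvT, if_false]
      have := h.le hT0 (b := v.den) (by exact_mod_cast not_lt.1 hvT)
      linarith
  let B : Set ℝ := ⋃ v ∈ S, Metric.closedBall (v : ℝ) (ρ v)
  -- The bound is `2 * (f / 10) + 16 * 45 * (6 / 5 * f) / 20000 < f / 4`; the interval is widened by
  -- `f / 10` on each side to hold the centres.
  have hB : volume B ≤ ENNReal.ofReal (f / 4) := by
    refine (h.volume_iUnion_closedBall_le hQ (a := a - f / 10) (l := 6 / 5 * f) (r := f / 10)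
      (K := 45) (by positivity) (by positivity) (by norm_num) ?_ ?_ hSρ ?_).trans
      (ENNReal.ofReal_le_ofReal (by linarith))
    · rintro v hv
      have h1 := hSρ v hv
      obtain ⟨-, -, x, hx, hxv⟩ := hv
      rw [hI] at hx
      have := abs_le.1 hxv
      constructor <;> linarith [hx.1, hx.2]
    · exact fun v hv => hwQ.trans hv.2.1
    · intro v _
      have := h.pos _ v.cast_den_pos
      simp only [ρ]
      split_ifs <;> linarith
  have hnotB : ∀ y ∈ contactInterval Ψ ω w, y ∉ B → ∀ v : ℚ, v ≠ w → w.den ≤ v.den →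
      ρ v < |y - v| := by
    intro y hy hyB v hvw hden
    by_contra hcon
    rw [not_lt] at hcon
    refine hyB ?_
    simp only [B, mem_iUnion, exists_prop]
    exact ⟨v, ⟨hvw, hden, y, hy, hcon⟩, by rwa [Metric.mem_closedBall, Real.dist_eq]⟩
  set τ : ℝ := min (Ψ T / 200) (f / 80) with hτ
  have hτ0 : 0 < τ := lt_min (by positivity) (by positivity)
  have hτ1 : τ ≤ Ψ T / 200 := min_le_left _ _
  have hτ2 : τ ≤ f / 80 := min_le_right _ _
  have hX40 : Tendsto (fun X : ℕ => (X : ℝ) / 40) atTop atTop :=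
    tendsto_natCast_atTop_atTop.atTop_div_const (by norm_num)
  have hg := (h.tendsto_sq_mul_zero.comp hX40).eventually (eventually_le_nhds hτ0)
  have hsq : Tendsto (fun X : ℕ => 40 / (X : ℝ) ^ 2) atTop (𝓝 0) :=
    tendsto_const_nhds.div_atTop
      ((tendsto_pow_atTop (by norm_num)).comp tendsto_natCast_atTop_atTop)
  filter_upwards [eventually_volume_not_approximable_le (a := a) hfpos, hg,
    hsq.eventually (eventually_le_nhds hτ0), hX40.eventually (eventually_ge_atTop (T : ℝ)),
    eventually_ge_atTop 40] with X hDir hgX hsqX hXT hX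
  simp only [Function.comp_apply] at hgX
  have hXr : (40 : ℝ) ≤ X := by exact_mod_cast hX
  have hX0 : (0 : ℝ) < X := by linarith
  let Z : Set ℝ := {x ∈ Icc a (a + f) |
      ¬ ∃ w : ℚ, (X : ℝ) / 40 ≤ w.den ∧ w.den ≤ X ∧ |x - w| ≤ 40 / (X : ℝ) ^ 2}
  let Y : Set ℝ := Icc (a + f / 20) (a + f - f / 20) \ (B ∪ Z)
  let G : Set ℚ := {u | (X : ℝ) / 40 ≤ u.den ∧ u.den ≤ X ∧ ∃ y ∈ Y, |y - u| ≤ 40 / (X : ℝ) ^ 2}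
  have hYI : ∀ y ∈ Y, y ∈ Icc a (a + f) := by
    rintro y ⟨⟨h1, h2⟩, -⟩
    constructor <;> linarith
  have hGI : ∀ u ∈ G, (u : ℝ) ∈ Icc (a + f / 20 - τ) (a + f - f / 20 + τ) := by
    rintro u ⟨-, -, y, hy, hyu⟩
    have h1 := hy.1.1
    have h2 := hy.1.2
    have := abs_le.1 (hyu.trans hsqX)
    constructor <;> linarith
  have hGfin : G.Finite := (Rat.finite_den_le _ _ X).subset fun u hu => ⟨hu.2.1, hGI u hu⟩
  refine ⟨hGfin.toFinset, ?_, ?_⟩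
  -- What remains has length at least `(9 / 10 - 1 / 4 - 1 / 10) * f > f / 2`, and each child covers
  -- only `80 / X ^ 2`.
  · have hcover : Icc (a + f / 20) (a + f - f / 20) ⊆
        (⋃ u ∈ hGfin.toFinset, Metric.closedBall (u : ℝ) (40 / (X : ℝ) ^ 2)) ∪ (B ∪ Z) := by
      intro y hy
      by_cases hyBZ : y ∈ B ∪ Z
      · exact Or.inr hyBZ
      · left
        have hyY : y ∈ Y := ⟨hy, hyBZ⟩
        have : ∃ w : ℚ, (X : ℝ) / 40 ≤ w.den ∧ w.den ≤ X ∧ |y - w| ≤ 40 / (X : ℝ) ^ 2 := by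
          by_contra hcon
          exact hyBZ (Or.inr ⟨hYI y hyY, hcon⟩)
        obtain ⟨u, hu1, hu2, hu3⟩ := this
        simp only [mem_iUnion, Set.Finite.mem_toFinset, exists_prop]
        exact ⟨u, ⟨hu1, hu2, y, hyY, hu3⟩, by rwa [Metric.mem_closedBall, Real.dist_eq]⟩
    have hvol := (measure_mono (μ := volume) hcover).trans ((measure_union_le _ _).trans
      (add_le_add (measure_biUnion_finset_le _ _) ((measure_union_le _ _).trans
        (add_le_add hB hDir))))
    simp only [Real.volume_closedBall, Real.volume_Icc] at hvol
    rw [Finset.sum_const, nsmul_eq_mul, ← ENNReal.ofReal_natCast, ← ENNReal.ofReal_mul (by positivity),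
      ← ENNReal.ofReal_add (by positivity) (by positivity),
      ← ENNReal.ofReal_add (by positivity) (by positivity),
      ENNReal.ofReal_le_ofReal_iff (by positivity)] at hvol
    have h1 : f / 2 ≤ hGfin.toFinset.card * (80 / (X : ℝ) ^ 2) := by
      have : (hGfin.toFinset.card : ℝ) * (2 * (40 / (X : ℝ) ^ 2)) =
        hGfin.toFinset.card * (80 / (X : ℝ) ^ 2) := by ring
      linarith
    rw [mul_div_assoc', le_div_iff₀ (by positivity)] at h1
    linarith
  · intro u hu
    rw [Set.Finite.mem_toFinset] at hu
    have huI := hGI u hu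
    obtain ⟨hu1, hu2, y, hyY, hyu⟩ := hu
    have hyI : y ∈ contactInterval Ψ ω w := hI ▸ hYI y hyY
    have hyB : y ∉ B := fun hy => hyY.2 (Or.inl hy)
    have hud := u.cast_den_pos
    have hud1 : (1 : ℝ) ≤ u.den := by linarith
    have huT : T ≤ u.den := by exact_mod_cast hXT.trans hu1
    have hΨu := h.pos _ hud
    have hgu : (u.den : ℝ) ^ 2 * Ψ u.den ≤ τ :=
      (h.sq_mul_le (by linarith) hu1).trans hgX
    have hΨuτ : Ψ u.den ≤ τ := by
      refine le_trans ?_ hgu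
      exact le_mul_of_one_le_left hΨu.le (one_le_pow₀ hud1)
    have hyuτ : |y - u| ≤ τ := hyu.trans hsqX
    have hsmall : ∀ v : ℚ, v.den < T → Ψ T / 2 ≤ |y - v| := by
      intro v hvT
      rcases lt_or_ge v.den w.den with hlt | hge
      · linarith [h.le_abs_sub_of_isRemote hw hlt hyI]
      · by_cases hvw : v = w
        · have := (hYI y hyY).1
          rw [hvw]
          refine le_trans ?_ (le_abs_self _)
          linarith
        · have h1 := hnotB y hyI hyB v hvw hge
          simp only [ρ, hvT, if_true] at h1
          have := h.le v.cast_den_pos (b := T) (by exact_mod_cast hvT.le)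
          linarith
    have hlarge : ∀ v : ℚ, T ≤ v.den → v.den < u.den → 44 * Ψ v.den ≤ |(u : ℝ) - v| := by
      intro v hvT hvu
      have hvd := v.cast_den_pos
      have hΨv := h.pos _ hvd
      have hvw : v ≠ w := by rintro rfl; omega
      by_cases hbig : 40 / (X : ℝ) ^ 2 ≤ Ψ v.den
      · have h1 := hnotB y hyI hyB v hvw (hT2.le.trans hvT)
        simp only [ρ, not_lt.2 hvT, if_false] at h1
        have := abs_sub_le y u v
        linarith
      · rw [not_le] at hbig
        -- When `Ψ` at `v` is below the Dirichlet error, the trivial spacing of rationals suffices: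
        -- after squaring, `44 ^ 2 * 40 / 100000 < 1`.
        refine le_trans ?_ (Rat.inv_den_mul_den_le (u := u) (v := v) (by rintro rfl; omega))
        rw [le_div_iff₀ (by positivity)]
        have he := hQ.sq_mul_le v.den (hwQ.trans (hT2.le.trans hvT))
        have hb : Ψ v.den * (u.den : ℝ) ^ 2 ≤ 40 := by
          rw [lt_div_iff₀ (by positivity)] at hbig
          have : (u.den : ℝ) ≤ X := by exact_mod_cast hu2
          have : Ψ v.den * (u.den : ℝ) ^ 2 ≤ Ψ v.den * (X : ℝ) ^ 2 := by gcongr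
          linarith
        rw [← sq_le_one_iff₀ (by positivity)]
        have h1 : (Ψ v.den * (u.den : ℝ) ^ 2) * ((v.den : ℝ) ^ 2 * Ψ v.den) ≤ 40 * (1 / 100000) := by
          gcongr
        linarith
    have hux : ∀ x ∈ contactInterval Ψ ω u, |x - u| ≤ τ := fun x hx =>
      (h.abs_sub_le_of_mem_contactInterval hx).trans hΨuτ
    have hsub : contactInterval Ψ ω u ⊆ contactInterval Ψ ω w := by
      intro x hx
      have := abs_le.1 (hux x hx)
      rw [hI]
      constructor <;> linarith [huI.1, huI.2]
    refine ⟨hu1, hu2, hT2.trans_le huT, ?_, hsub, ?_, ?_⟩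
    · intro v hvu
      have hvd := v.cast_den_pos
      have hvd1 : (1 : ℝ) ≤ v.den := by exact_mod_cast v.den_pos
      rw [div_le_iff₀ (by positivity)]
      rcases lt_or_ge v.den T with hvT | hvT
      · have h1 := hsmall v hvT
        have h2 := abs_sub_le y u v
        have h3 : 44 * τ ≤ |(u : ℝ) - v| := by linarith
        have h4 : |(u : ℝ) - v| * 1 ≤ |(u : ℝ) - v| * (v.den : ℝ) ^ 2 := by
          gcongr
          exact one_le_pow₀ hvd1
        linarith
      · have h1 := hlarge v hvT hvu
        have h2 := h.sq_mul_le hvd (b := u.den) (by exact_mod_cast hvu.le)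
        have h3 : 44 * Ψ v.den * (v.den : ℝ) ^ 2 ≤ |(u : ℝ) - v| * (v.den : ℝ) ^ 2 := by gcongr
        linarith
    · rw [hI]
      constructor <;> linarith [huI.1, huI.2]
    · intro x hx v hwv hvu
      have hvd := v.cast_den_pos
      have hΨv := h.pos _ hvd
      have hωv := (h.omega_mem _ hvd).1
      by_cases hvw : v = w
      · rw [hvw]
        refine le_trans ?_ (le_abs_self _)
        have := (hsub hx).1
        rw [← hf, ← ha] at this
        linarith
      · have hle : (1 - ω v.den) * Ψ v.den ≤ Ψ v.den := by nlinarith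
        refine hle.trans ?_
        have hxu := hux x hx
        rw [abs_sub_comm] at hxu
        have h2 := abs_sub_le (u : ℝ) x v
        rcases lt_or_ge v.den T with hvT | hvT
        · have h1 := hnotB y hyI hyB v hvw hwv
          simp only [ρ, hvT, if_true] at h1
          have h3 := h.le hvd (b := T) (by exact_mod_cast hvT.le)
          have h4 := abs_sub_le y u v
          linarith
        · have h1 := hlarge v hvT hvu
          have h3 := h.abs_sub_le_of_mem_contactInterval hx
          rw [abs_sub_comm] at h3
          have h4 := h.le hvd (b := u.den) (by exact_mod_cast hvu.le)
          linarith

/-- A good approximation to the badly approximable `√2` cannot be near a rational of much smaller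
denominator; for comparable denominators the spacing of rationals suffices. -/
lemma exists_isRemote {Q : ℕ} (hQ : IsThreshold Ψ ω Q) :
    ∃ w : ℚ, Q ≤ w.den ∧ IsRemote Ψ w := by
  obtain ⟨w, hw, hwQ⟩ : ∃ w ∈ {q : ℚ | |√2 - q| < 1 / (q.den : ℝ) ^ 2}, Q ≤ w.den := by
    by_contra! hcon
    refine Real.infinite_rat_abs_sub_lt_one_div_den_sq_of_irrational irrational_sqrt_two
      ((Rat.finite_den_le (√2 - 1) (√2 + 1) Q).subset fun v hv => ⟨(hcon v hv).le, ?_⟩)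
    have hd : (1 : ℝ) ≤ v.den := by exact_mod_cast v.den_pos
    have h1 : |√2 - v| ≤ 1 := (le_of_lt hv).trans <| by
      rw [div_le_one (by positivity)]
      exact one_le_pow₀ hd
    have := abs_le.1 h1
    constructor <;> linarith
  change |√2 - w| < 1 / (w.den : ℝ) ^ 2 at hw
  refine ⟨w, hwQ, fun v hv => ?_⟩
  have he := hQ.sq_mul_le _ hwQ
  have hd := v.cast_den_pos
  have hdw := w.cast_den_pos
  have hvw : (v.den : ℝ) < w.den := by exact_mod_cast hv
  have hsqrt : √2 ^ 2 = 2 := Real.sq_sqrt (by norm_num)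
  have hsqrt0 := Real.sqrt_nonneg 2
  have hsqrt2 : √2 ≤ 3 / 2 := by nlinarith
  rw [div_le_iff₀ (by positivity)]
  rcases le_or_gt ((v.den : ℝ) * 3) w.den with hle | hgt
  · have hbad : 1 / 4 ≤ |√2 - v| * (v.den : ℝ) ^ 2 := by
      have hvnum : (v : ℝ) * v.den = v.num := by
        rw [v.cast_eq_num_div_den]; field_simp
      have hne : 2 * (v.den : ℤ) ^ 2 - v.num ^ 2 ≠ 0 := by
        intro h0
        have h1 : (2 : ℝ) * (v.den : ℝ) ^ 2 - (v.num : ℝ) ^ 2 = 0 := by exact_mod_cast h0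
        rw [← hvnum] at h1
        have h2 : (v : ℝ) ^ 2 = 2 := by
          have : (v.den : ℝ) ^ 2 ≠ 0 := by positivity
          have h3 : (2 - (v : ℝ) ^ 2) * (v.den : ℝ) ^ 2 = 0 := by linarith
          have := (mul_eq_zero.1 h3).resolve_right this
          linarith
        have h3 : |(v : ℝ)| = √2 := by rw [← h2, Real.sqrt_sq_eq_abs]
        refine irrational_sqrt_two ⟨|v|, ?_⟩
        push_cast
        exact h3
      have h1 : (1 : ℝ) ≤ |2 * (v.den : ℝ) ^ 2 - (v.num : ℝ) ^ 2| := by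
        exact_mod_cast Int.one_le_abs hne
      have h2 : 2 * (v.den : ℝ) ^ 2 - (v.num : ℝ) ^ 2 =
          (√2 - v) * (√2 + v) * (v.den : ℝ) ^ 2 := by
        rw [← hvnum]; linear_combination -(v.den : ℝ) ^ 2 * hsqrt
      rw [h2, abs_mul, abs_mul, abs_of_pos (show (0 : ℝ) < (v.den : ℝ) ^ 2 by positivity)] at h1
      rcases le_or_gt |√2 - v| 1 with hs | hs
      · have h3 : |√2 + v| ≤ 4 := by
          have := abs_le.1 hs
          rw [abs_le]; constructor <;> linarith
        have h4 : |√2 - v| * |√2 + v| * (v.den : ℝ) ^ 2 ≤ |√2 - v| * 4 * (v.den : ℝ) ^ 2 := by gcongr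
        linarith
      · have h3 : (1 : ℝ) ≤ (v.den : ℝ) ^ 2 := one_le_pow₀ (by exact_mod_cast v.den_pos)
        nlinarith
    have h3 : |√2 - v| ≤ |√2 - w| + |(w : ℝ) - v| := abs_sub_le _ _ _
    have h4 : |√2 - v| * (v.den : ℝ) ^ 2 ≤
        1 / (w.den : ℝ) ^ 2 * (v.den : ℝ) ^ 2 + |(w : ℝ) - v| * (v.den : ℝ) ^ 2 := by
      rw [← add_mul]
      gcongr
      linarith
    have h5 : 1 / (w.den : ℝ) ^ 2 * (v.den : ℝ) ^ 2 ≤ 1 / 9 := by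
      rw [one_div_mul_eq_div, div_le_div_iff₀ (by positivity) (by norm_num)]
      nlinarith
    linarith
  · have h1 := Rat.inv_den_mul_den_le (u := w) (v := v) (by rintro rfl; omega)
    have h2 : 1 / ((w.den : ℝ) * v.den) * (v.den : ℝ) ^ 2 ≤ |(w : ℝ) - v| * (v.den : ℝ) ^ 2 := by gcongr
    have h3 : 1 / ((w.den : ℝ) * v.den) * (v.den : ℝ) ^ 2 = v.den / w.den := by field_simp
    have h4 : 1 / 3 ≤ (v.den : ℝ) / w.den := by
      rw [div_le_div_iff₀ (by norm_num) hdw]; linarith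
    linarith

end Admissible

/-! ### Mass distribution on a tree -/

open MeasureTheory in
/-- A lower bound for the dimension of a set containing all points which lie in the intervals along
some branch of a tree, in which each node of level `k` has `n k` children and intervals of distinct
nodes of level `k` are at distance at least `δ k`. -/
theorem le_dimH_of_tree {n : ℕ → ℕ} (hn : ∀ k, 2 ≤ n k) {s A : ℝ} (hs : 0 < s) (hs1 : s ≤ 1)
    (hA : 0 < A) {node : ℕ → (∀ k, Fin (n k)) → ℚ} (hmeas : ∀ k, Measurable (node k))
    (hinj : ∀ k a b, node k a = node k b → ∀ i < k, a i = b i) {lo hi : ℚ → ℝ}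
    (hlohi : ∀ k a, lo (node k a) ≤ hi (node k a))
    (hlo : ∀ k a, lo (node k a) ≤ lo (node (k + 1) a))
    (hhi : ∀ k a, hi (node (k + 1) a) ≤ hi (node k a)) {δ : ℕ → ℝ} (hδ : ∀ k, 0 < δ k)
    (hδ0 : Tendsto δ atTop (𝓝 0))
    (hsep : ∀ k a b, node k a ≠ node k b → ∀ x ∈ Icc (lo (node k a)) (hi (node k a)),
      ∀ y ∈ Icc (lo (node k b)) (hi (node k b)), δ k ≤ |x - y|)
    (hmass : ∀ k, ∏ i ∈ Finset.range k, (1 / (n i : ℝ)) ≤ A * (n k * δ (k + 1)) ^ s) {E : Set ℝ}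
    (hE : ∀ a x, (∀ k, x ∈ Icc (lo (node k a)) (hi (node k a))) → x ∈ E) :
    ENNReal.ofReal s ≤ dimH E := by
  classical
  have hne : ∀ k, NeZero (n k) := fun k => ⟨by have := hn k; omega⟩
  have hnpos : ∀ k, (0 : ℝ) < n k := fun k => by have := hn k; positivity
  let ν : ∀ k, Measure (Fin (n k)) := fun k => ProbabilityTheory.uniformOn univ
  have hν : ∀ k, IsProbabilityMeasure (ν k) := fun k =>
    ProbabilityTheory.isProbabilityMeasure_uniformOn finite_univ univ_nonempty
  let P : Measure (∀ k, Fin (n k)) := Measure.infinitePi ν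
  let m : ℕ → ℝ := fun k => ∏ i ∈ Finset.range k, (1 / (n i : ℝ))
  have hm0 : ∀ k, 0 < m k := fun k => Finset.prod_pos fun i _ => by have := hnpos i; positivity
  have hlomono : ∀ a, Monotone fun k => lo (node k a) := fun a => monotone_nat_of_le_succ (hlo · a)
  have hhianti : ∀ a, Antitone fun k => hi (node k a) := fun a => antitone_nat_of_succ_le (hhi · a)
  have hcross : ∀ a j k, lo (node j a) ≤ hi (node k a) := fun a j k =>
    (hlomono a (le_max_left j k)).trans ((hlohi _ a).trans (hhianti a (le_max_right j k)))
  -- The supremum of the left endpoints is a measurable choice of a point on each branch; the mass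
  -- distribution is the image under `φ` of the uniform product measure.
  let φ : (∀ k, Fin (n k)) → ℝ := fun a => ⨆ k, lo (node k a)
  have hφ : ∀ a k, φ a ∈ Icc (lo (node k a)) (hi (node k a)) := fun a k =>
    ⟨le_ciSup (f := fun k => lo (node k a)) ⟨hi (node 0 a), by rintro _ ⟨j, rfl⟩; exact hcross a j 0⟩ k,
      ciSup_le fun j => hcross a j k⟩
  have hφmeas : Measurable φ := Measurable.iSup fun k => (Measurable.of_discrete).comp (hmeas k)
  have hcyl : ∀ k a, P {b | node k b = node k a} ≤ ENNReal.ofReal (m k) := by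
    intro k a
    have hsub : {b | node k b = node k a} ⊆
        ((Finset.range k : Finset ℕ) : Set ℕ).pi (fun i => ({a i} : Set (Fin (n i)))) := by
      intro b hb i hi
      exact hinj k b a hb i (by simpa using hi)
    refine (measure_mono hsub).trans (le_of_eq ?_)
    rw [Measure.infinitePi_pi ν (fun i _ => measurableSet_singleton _),
      ENNReal.ofReal_prod_of_nonneg (fun i _ => by have := hnpos i; positivity)]
    refine Finset.prod_congr rfl fun i _ => ?_
    simp only [ν]
    rw [ProbabilityTheory.uniformOn_univ, Measure.count_singleton, Fintype.card_fin,
      ENNReal.ofReal_div_of_pos (hnpos i)]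
    simp
  have hcount : ∀ k (U : Set ℝ) (r : ℝ), 0 ≤ r → (∀ x ∈ U, ∀ y ∈ U, |x - y| ≤ r) →
      ∃ N : ℕ, (N : ℝ) ≤ r / δ k + 1 ∧ P (φ ⁻¹' U) ≤ ENNReal.ofReal (N * m k) := by
    intro k U r hr hU
    let W : Set ℚ := {w | ∃ a, node k a = w ∧ φ a ∈ U}
    have hW : ∀ F : Finset ℚ, (F : Set ℚ) ⊆ W → (F.card : ℝ) ≤ r / δ k + 1 := by
      intro F hF
      rcases F.eq_empty_or_nonempty with rfl | hFne
      · have := hδ k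
        simp only [Finset.card_empty, Nat.cast_zero]; positivity
      choose! c hc1 hc2 using fun (w : ℚ) (hw : w ∈ F) => hF hw
      have hsepc : ∀ u ∈ F, ∀ v ∈ F, u ≠ v → δ k ≤ |φ (c u) - φ (c v)| := fun u hu v hv huv =>
        hsep k (c u) (c v) (by rwa [hc1 u hu, hc1 v hv]) _ (hφ _ k) _ (hφ _ k)
      have hcinj : Set.InjOn (fun w => φ (c w)) F := by
        intro u hu v hv huv
        by_contra hne
        have := hsepc u hu v hv hne
        simp only at huv
        rw [huv, sub_self, abs_zero] at this
        linarith [hδ k]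
      rw [← Finset.card_image_of_injOn hcinj]
      have hFne' := hFne.image fun w => φ (c w)
      obtain ⟨w₁, hw₁, hmin⟩ := Finset.mem_image.1 (Finset.min'_mem _ hFne')
      refine card_le_of_separated (a := (F.image fun w => φ (c w)).min' hFne') (hδ k) hr ?_ ?_
      · intro x hx
        refine ⟨Finset.min'_le _ _ hx, ?_⟩
        obtain ⟨w, hw, rfl⟩ := Finset.mem_image.1 hx
        rw [← hmin]
        have := abs_le.1 (hU _ (hc2 w hw) _ (hc2 w₁ hw₁))
        linarith
      · intro x hx y hy hxy
        obtain ⟨u, hu, rfl⟩ := Finset.mem_image.1 hx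
        obtain ⟨v, hv, rfl⟩ := Finset.mem_image.1 hy
        exact hsepc u hu v hv fun h => hxy (by rw [h])
    have hWfin : W.Finite := by
      by_contra hinf
      obtain ⟨F, hF, hcard⟩ := Set.Infinite.exists_subset_card_eq hinf (⌊r / δ k + 1⌋₊ + 1)
      have h1 := hW F hF
      rw [hcard] at h1
      have h2 := Nat.lt_floor_add_one (r / δ k + 1)
      push_cast at h1
      linarith
    refine ⟨hWfin.toFinset.card, hW _ (by simp), ?_⟩
    have hsub : φ ⁻¹' U ⊆ ⋃ w ∈ hWfin.toFinset, {b | node k b = w} := by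
      intro b hb
      simp only [mem_iUnion, Set.Finite.mem_toFinset, exists_prop]
      exact ⟨node k b, ⟨b, rfl, hb⟩, rfl⟩
    refine (measure_mono hsub).trans ((measure_biUnion_finset_le _ _).trans ?_)
    rw [ENNReal.ofReal_mul (by positivity), ENNReal.ofReal_natCast, ← nsmul_eq_mul]
    refine Finset.sum_le_card_nsmul _ _ _ fun w hw => ?_
    obtain ⟨a, rfl, -⟩ := hWfin.mem_toFinset.1 hw
    exact hcyl k a
  have hsmall : ∀ k (U : Set ℝ) (r : ℝ), 0 ≤ r → r < δ k → (∀ x ∈ U, ∀ y ∈ U, |x - y| ≤ r) →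
      P (φ ⁻¹' U) ≤ ENNReal.ofReal (m k) := by
    intro k U r hr hrδ hU
    obtain ⟨N, hN, hP⟩ := hcount k U r hr hU
    have h1 : r / δ k < 1 := (div_lt_one (hδ k)).2 hrδ
    have h2 : (N : ℝ) < 2 := by linarith
    have h3 : N ≤ 1 := by
      have : N < 2 := by exact_mod_cast h2
      omega
    refine hP.trans (ENNReal.ofReal_le_ofReal ?_)
    have h4 : (N : ℝ) ≤ 1 := by exact_mod_cast h3
    have := hm0 k
    nlinarith
  have hmtend : Tendsto (fun k => ENNReal.ofReal (m k)) atTop (𝓝 0) := by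
    have h1 : Tendsto m atTop (𝓝 0) := by
      refine squeeze_zero (fun k => (hm0 k).le) (fun k => ?_)
        (tendsto_pow_atTop_nhds_zero_of_lt_one (show (0 : ℝ) ≤ 1 / 2 by norm_num) (by norm_num))
      calc m k ≤ ∏ i ∈ Finset.range k, (1 / 2 : ℝ) := by
            refine Finset.prod_le_prod (fun i _ => by positivity) fun i _ => ?_
            have : (2 : ℝ) ≤ n i := by exact_mod_cast hn i
            gcongr
        _ = _ := by simp
    simpa using ENNReal.tendsto_ofReal h1
  set A' : ℝ := A * 2 ^ s + (δ 0) ^ (-s) with hA'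
  have hδ0pos := hδ 0
  have hA'0 : 0 < A' := by positivity
  have hmain : ∀ (U : Set ℝ) (r : ℝ), 0 ≤ r → (∀ x ∈ U, ∀ y ∈ U, |x - y| ≤ r) →
      P (φ ⁻¹' U) ≤ ENNReal.ofReal (A' * r ^ s) := by
    intro U r hr hU
    rcases hr.eq_or_lt with rfl | hr0
    · refine le_trans (ge_of_tendsto' hmtend fun k => hsmall k U 0 le_rfl (hδ k) hU) bot_le
    -- The least such index gives `δ (k + 1) ≤ r < δ k`, without monotonicity of `δ`; index 0 is
    -- covered by the extra term in `A'`.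
    have hex : ∃ k, δ k ≤ r := (hδ0.eventually (eventually_le_nhds hr0)).exists
    have hspec := Nat.find_spec hex
    rcases hk : Nat.find hex with _ | k
    · rw [hk] at hspec
      refine prob_le_one.trans ?_
      rw [ENNReal.one_le_ofReal]
      calc (1 : ℝ) ≤ (r / δ 0) ^ s := Real.one_le_rpow ((one_le_div hδ0pos).2 hspec) hs.le
        _ = (δ 0) ^ (-s) * r ^ s := by
          rw [Real.div_rpow hr hδ0pos.le, Real.rpow_neg hδ0pos.le]; field_simp
        _ ≤ A' * r ^ s := by
          gcongr
          rw [hA']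
          linarith [show 0 < A * (2 : ℝ) ^ s by positivity]
    · rw [hk] at hspec
      have hlt : r < δ k := by
        have := Nat.find_min hex (m := k) (by omega)
        rwa [not_le] at this
      have hn0 := hnpos k
      have hδk := hδ (k + 1)
      have hmk := hm0 k
      have h1 := hsmall k U r hr hlt hU
      obtain ⟨N, hN, hP⟩ := hcount (k + 1) U r hr hU
      have hmsucc : m (k + 1) = m k * (1 / n k) := Finset.prod_range_succ _ _
      set z : ℝ := 2 * r / (n k * δ (k + 1)) with hz
      have hz0 : 0 < z := by positivity
      have hNz : N * m (k + 1) ≤ m k * z := by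
        have h2 : 1 ≤ r / δ (k + 1) := (one_le_div hδk).2 hspec
        calc N * m (k + 1) ≤ (2 * (r / δ (k + 1))) * m (k + 1) := by
              have := hm0 (k + 1)
              gcongr
              linarith
          _ = m k * z := by rw [hmsucc, hz]; field_simp
      -- The mass is at most `m k * min 1 z`, and `min 1 z ≤ z ^ s` because `0 < s ≤ 1`.
      have hmin : P (φ ⁻¹' U) ≤ ENNReal.ofReal (m k * z ^ s) := by
        rcases le_total z 1 with hz1 | hz1
        · refine hP.trans (ENNReal.ofReal_le_ofReal (hNz.trans ?_))
          gcongr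
          calc z = z ^ (1 : ℝ) := (Real.rpow_one z).symm
            _ ≤ z ^ s := Real.rpow_le_rpow_of_exponent_ge hz0 hz1 hs1
        · refine h1.trans (ENNReal.ofReal_le_ofReal ?_)
          exact le_mul_of_one_le_right hmk.le (Real.one_le_rpow hz1 hs.le)
      refine hmin.trans (ENNReal.ofReal_le_ofReal ?_)
      have hmk' : m k ≤ A * (n k * δ (k + 1)) ^ s := hmass k
      calc m k * z ^ s ≤ A * (n k * δ (k + 1)) ^ s * z ^ s := by gcongr
        _ = A * (2 * r) ^ s := by
          rw [mul_assoc, ← Real.mul_rpow (by positivity) hz0.le, hz]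
          congr 2
          field_simp
        _ = A * 2 ^ s * r ^ s := by rw [Real.mul_rpow (by norm_num) hr, mul_assoc]
        _ ≤ A' * r ^ s := by
          gcongr
          rw [hA']
          linarith [show 0 < (δ 0) ^ (-s) by positivity]
  have hle : (ENNReal.ofReal A')⁻¹ • Measure.map φ P ≤ Measure.hausdorffMeasure s := by
    -- Passing to the closure makes the set measurable without changing its diameter.
    refine Measure.le_hausdorffMeasure s _ 1 one_pos fun U hU => ?_
    have hfin : Metric.ediam (closure U) ≠ ⊤ := by
      rw [Metric.ediam_closure]; exact ne_top_of_le_ne_top ENNReal.one_ne_top hU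
    rw [Measure.smul_apply, smul_eq_mul, mul_comm, ← div_eq_mul_inv,
      ENNReal.div_le_iff_le_mul (Or.inl (by simpa using hA'0)) (Or.inl ENNReal.ofReal_ne_top)]
    calc Measure.map φ P U ≤ Measure.map φ P (closure U) := measure_mono subset_closure
      _ = P (φ ⁻¹' closure U) := Measure.map_apply hφmeas isClosed_closure.measurableSet
      _ ≤ ENNReal.ofReal (A' * (Metric.ediam (closure U)).toReal ^ s) := by
        refine hmain _ _ ENNReal.toReal_nonneg fun x hx y hy => ?_
        rw [← Real.dist_eq, ← ENNReal.ofReal_le_iff_le_toReal hfin, ← edist_dist]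
        exact Metric.edist_le_ediam_of_mem hx hy
      _ = Metric.ediam U ^ s * ENNReal.ofReal A' := by
        rw [ENNReal.ofReal_mul hA'0.le, ← ENNReal.ofReal_rpow_of_nonneg ENNReal.toReal_nonneg hs.le,
          ENNReal.ofReal_toReal hfin, Metric.ediam_closure, mul_comm]
  have hpos : Measure.hausdorffMeasure ((s.toNNReal : ℝ≥0) : ℝ) E ≠ 0 := by
    rw [Real.coe_toNNReal s hs.le]
    intro h0
    have h1 := hle E
    rw [h0, Measure.smul_apply, smul_eq_mul, nonpos_iff_eq_zero, mul_eq_zero] at h1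
    have h2 : P (φ ⁻¹' E) ≤ Measure.map φ P E := Measure.le_map_apply hφmeas.aemeasurable E
    have h3 : φ ⁻¹' E = univ := eq_univ_of_forall fun a => hE a _ (hφ a)
    rw [h3, measure_univ] at h2
    rcases h1 with h1 | h1
    · simp at h1
    · rw [h1] at h2; simp at h2
  exact le_dimH_of_hausdorffMeasure_ne_zero hpos

namespace Admissible

variable {Ψ ω : ℝ → ℝ}

/-! ### The lower bound for the dimension -/

/-- Otherwise `(Ψ n * ω n) ^ s` is `O(n ^ (-2))`, and the series converges at any `s' > s`, in
particular at one below the convergence exponent. -/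
lemma frequently_le_sq_mul_rpow (h : Admissible Ψ ω) {s : ℝ} (hs : 0 < s)
    (hlt : ENNReal.ofReal s < convergenceExponent Ψ ω) (M : ℝ) :
    ∃ᶠ n : ℕ in atTop, M ≤ (n : ℝ) ^ 2 * (Ψ n * ω n) ^ s := by
  intro hcon
  obtain ⟨s', hs1, hs2⟩ := ENNReal.lt_iff_exists_nnreal_btwn.1 hlt
  have hss : s < s' := by
    rw [← ENNReal.ofReal_coe_nnreal, ENNReal.ofReal_lt_ofReal_iff_of_nonneg hs.le] at hs1
    exact hs1
  refine absurd (sInf_le (show (s' : ℝ≥0∞) ∈ {t : ℝ≥0∞ | ∃ s : ℝ≥0, t = (s : ℝ≥0∞) ∧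
    Summable fun q : ℕ => (q : ℝ) * (Ψ q * ω q) ^ (s : ℝ)} from ⟨s', rfl, ?_⟩)) (not_le.2 hs2)
  have hr : 1 < s' / s := (one_lt_div hs).2 hss
  have hsum : Summable fun n : ℕ => M ^ (s' / s : ℝ) * (n : ℝ) ^ (1 - 2 * (s' / s)) :=
    (Real.summable_nat_rpow.2 (by linarith)).mul_left _
  refine Summable.of_norm_bounded_eventually_nat hsum ?_
  filter_upwards [hcon, eventually_ge_atTop 1] with n hn hn1
  have hn0 : (0 : ℝ) < n := by exact_mod_cast hn1
  have hf := h.mul_pos hn0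
  rw [not_le] at hn
  have hM : 0 < M := lt_of_le_of_lt (by positivity) hn
  rw [Real.norm_of_nonneg (by positivity)]
  have h1 : (Ψ n * ω n) ^ s ≤ M * (n : ℝ) ^ (-2 : ℝ) := by
    rw [Real.rpow_neg hn0.le, ← div_eq_mul_inv, le_div_iff₀ (by positivity)]
    have : (n : ℝ) ^ (2 : ℝ) = (n : ℝ) ^ 2 := by norm_cast
    rw [this]
    linarith
  calc (n : ℝ) * (Ψ n * ω n) ^ (s' : ℝ) = n * ((Ψ n * ω n) ^ s) ^ (s' / s : ℝ) := by
        rw [← Real.rpow_mul hf.le, mul_div_cancel₀ _ hs.ne']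
    _ ≤ n * (M * (n : ℝ) ^ (-2 : ℝ)) ^ (s' / s : ℝ) := by gcongr
    _ = M ^ (s' / s : ℝ) * (n : ℝ) ^ (1 - 2 * (s' / s : ℝ)) := by
      rw [Real.mul_rpow hM.le (by positivity), ← Real.rpow_mul hn0.le, sub_eq_add_neg,
        Real.rpow_add hn0, Real.rpow_one]
      ring_nf

lemma lt_one_of_lt_convergenceExponent (h : Admissible Ψ ω) {s : ℝ} (hs : 0 < s)
    (hlt : ENNReal.ofReal s < convergenceExponent Ψ ω) : s < 1 := by
  by_contra hcon
  rw [not_lt] at hcon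
  obtain ⟨n, hn, hn1, hf1⟩ := ((h.frequently_le_sq_mul_rpow hs hlt (Ψ 1 * ω 1 + 1)).and_eventually
    ((eventually_ge_atTop 1).and
      (h.tendsto_mul_omega_zero.eventually (eventually_le_nhds one_pos)))).exists
  have hn1' : (1 : ℝ) ≤ n := by exact_mod_cast hn1
  have hf := h.mul_pos (q := n) (by linarith)
  have h1 : (Ψ n * ω n) ^ s ≤ Ψ n * ω n := by
    simpa using Real.rpow_le_rpow_of_exponent_ge hf hf1 hcon
  have h2 := h.sq_mul_mul_le one_pos hn1'
  have h3 : (n : ℝ) ^ 2 * (Ψ n * ω n) ^ s ≤ (n : ℝ) ^ 2 * (Ψ n * ω n) := by gcongr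
  linarith

/-- Intersections of contact intervals along a chain of rationals with increasing denominators, with
control of all intermediate denominators, consist of points of the exact set. -/
lemma mem_exactSet_of_chain (h : Admissible Ψ ω) {Q : ℕ} (hQ : IsThreshold Ψ ω Q) {w : ℕ → ℚ}
    (hwQ : Q ≤ (w 0).den) (hw : IsRemote Ψ (w 0)) (hmono : StrictMono fun k => (w k).den) {x : ℝ}
    (hx : ∀ k, x ∈ contactInterval Ψ ω (w k))
    (hfar : ∀ k, ∀ v : ℚ, (w k).den ≤ v.den → v.den < (w (k + 1)).den →
      (1 - ω v.den) * Ψ v.den ≤ |x - v|) : x ∈ exactSet Ψ ω := by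
  refine ⟨?_, ?_⟩
  · refine Set.infinite_of_injective_forall_mem (f := fun k : ℕ => ((w k).num, (w k).den)) ?_ ?_
    · intro j k hjk
      exact hmono.injective (Prod.ext_iff.1 hjk).2
    · intro k
      refine ⟨(w k).den_pos, ?_⟩
      rw [← (w k).cast_eq_num_div_den]
      exact h.abs_sub_le_of_mem_contactInterval (hx k)
  · have hfar' : ∀ v : ℚ, (w 0).den ≤ v.den → (1 - ω v.den) * Ψ v.den ≤ |x - v| := by
      intro v hv
      have hex : ∃ k, v.den < (w k).den := ⟨v.den + 1, hmono.le_apply (x := v.den + 1)⟩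
      have hspec := Nat.find_spec hex
      rcases hk : Nat.find hex with _ | k
      · rw [hk] at hspec; omega
      · rw [hk] at hspec
        exact hfar k v (not_lt.1 (Nat.find_min hex (m := k) (by omega))) hspec
    filter_upwards [eventually_ge_atTop (w 0).den] with q hq p
    have hq1 : 0 < q := (w 0).den_pos.trans_le hq
    have hq0 : (0 : ℝ) < q := by exact_mod_cast hq1
    have hΨ := h.pos q hq0
    have hω := (h.omega_mem q hq0).1
    have hle : (1 - ω q) * Ψ q ≤ Ψ q := by nlinarith
    obtain ⟨v, hv⟩ : ∃ v : ℚ, v = p / q := ⟨_, rfl⟩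
    have hdvd : v.den ∣ q := by
      have := Rat.den_dvd p q
      rw [Rat.divInt_eq_div] at this
      rw [hv]
      exact_mod_cast this
    have hvr : (v : ℝ) = p / q := by rw [hv]; push_cast; rfl
    rw [← hvr]
    rcases lt_or_ge v.den (w 0).den with hlt | hge
    · refine hle.trans (le_trans ?_ (h.le_abs_sub_of_isRemote hw hlt (hx 0)))
      exact h.le (w 0).cast_den_pos (by exact_mod_cast hq)
    · have hvfar := hfar' v hge
      obtain ⟨c, hc⟩ := hdvd
      have hvd := v.cast_den_pos
      have hΨv := h.pos _ hvd
      rcases Nat.lt_or_ge c 2 with hc2 | hc2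
      · have : c = 1 := by
          have : c ≠ 0 := by rintro rfl; omega
          omega
        rw [this, mul_one] at hc
        rw [hc]
        exact hvfar
      -- A fraction that is not reduced needs no separate control: its index at least doubles the
      -- reduced denominator, so `Ψ q ≤ Ψ v.den / 4`, while `1 - ω v.den ≥ 11 / 12`.
      · have h2 : 2 * (v.den : ℝ) ≤ q := by
          rw [hc]; push_cast
          have : (2 : ℝ) ≤ c := by exact_mod_cast hc2
          nlinarith
        have h3 := h.sq_mul_le hvd (b := q) (by linarith)
        have h4 : (2 * (v.den : ℝ)) ^ 2 * Ψ q ≤ (q : ℝ) ^ 2 * Ψ q := by gcongr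
        have h5 : 4 * Ψ q ≤ Ψ v.den := by
          refine le_of_mul_le_mul_left ?_ (show 0 < (v.den : ℝ) ^ 2 by positivity)
          linarith
        have h6 := hQ.omega_le _ (hwQ.trans hge)
        nlinarith

/-- The nodes of a tree of rationals with denominators comparable to `X` over the base `w₀`. -/
def nodeSet (Ψ ω : ℝ → ℝ) (w₀ : ℚ) (X : ℕ) : Set ℚ :=
  {w | w₀.den ≤ w.den ∧ (X : ℝ) / 40 ≤ w.den ∧ w.den ≤ X ∧ IsRemote Ψ w ∧
    (w : ℝ) ∈ Icc (w₀ : ℝ) (w₀ + 1) ∧ contactInterval Ψ ω w ⊆ Icc (w₀ : ℝ) (w₀ + 1)}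

/-- Distinct nodes are `1 / X ^ 2` apart, and each contact interval stays within `1 / (4 * X ^ 2)`
of its node because denominators are at least `X / 40`. -/
lemma one_div_le_abs_sub_of_mem_nodeSet (h : Admissible Ψ ω) {Q : ℕ} (hQ : IsThreshold Ψ ω Q) {w₀ : ℚ}
    (hw₀ : Q ≤ w₀.den) {X : ℕ} (hX : 0 < X) {u v : ℚ} (hu : u ∈ nodeSet Ψ ω w₀ X)
    (hv : v ∈ nodeSet Ψ ω w₀ X) (huv : u ≠ v) {x y : ℝ} (hx : x ∈ contactInterval Ψ ω u)
    (hy : y ∈ contactInterval Ψ ω v) : 1 / (2 * (X : ℝ) ^ 2) ≤ |x - y| := by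
  have hX0 : (0 : ℝ) < X := by exact_mod_cast hX
  have hsmall : ∀ w ∈ nodeSet Ψ ω w₀ X, ∀ z ∈ contactInterval Ψ ω w,
      |z - w| ≤ 1 / (4 * (X : ℝ) ^ 2) := by
    intro w hw z hz
    refine (h.abs_sub_le_of_mem_contactInterval hz).trans ?_
    have h1 := hQ.sq_mul_le w.den (hw₀.trans hw.1)
    have h2 := h.pos _ w.cast_den_pos
    have h3 : ((X : ℝ) / 40) ^ 2 * Ψ w.den ≤ (w.den : ℝ) ^ 2 * Ψ w.den := by
      have := hw.2.1
      gcongr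
    rw [le_div_iff₀ (by positivity)]
    linarith
  have h1 := Rat.inv_sq_le_abs_sub huv (D := X) (by exact_mod_cast hu.2.2.1)
    (by exact_mod_cast hv.2.2.1)
  have h2 := abs_le.1 (hsmall u hu x hx)
  have h3 := abs_le.1 (hsmall v hv y hy)
  have h4 : 1 / (X : ℝ) ^ 2 = 4 * (1 / (4 * (X : ℝ) ^ 2)) := by field_simp
  have h5 : 1 / (2 * (X : ℝ) ^ 2) = 2 * (1 / (4 * (X : ℝ) ^ 2)) := by field_simp; norm_num
  rw [h5]
  rw [h4] at h1
  rcases le_abs.1 h1 with h6 | h6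
  · exact le_abs.2 (Or.inl (by linarith))
  · exact le_abs.2 (Or.inr (by linarith))

/-- There are finitely many nodes, so one large `X'` serves them all, and it can be taken among the
scales where `X' ^ 2 * (Ψ X' * ω X') ^ s` is large. Using `Ψ X * ω X`, a lower bound for `Ψ ω` at
every node, gives all nodes the same number of children. -/
lemma exists_next_level (h : Admissible Ψ ω) {Q : ℕ} (hQ : IsThreshold Ψ ω Q) {w₀ : ℚ}
    (hw₀ : Q ≤ w₀.den) {s : ℝ} (hs : 0 < s)
    (hlt : ENNReal.ofReal s < convergenceExponent Ψ ω) {X : ℕ} (hX : 0 < X) :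
    ∃ X' : ℕ, X < X' ∧ 2 ≤ (X' : ℝ) ^ 2 * (Ψ X * ω X) / 160 ∧
      320 / (Ψ X * ω X) ≤ (X' : ℝ) ^ 2 * (Ψ X' * ω X') ^ s ∧
      ∀ w ∈ nodeSet Ψ ω w₀ X, ∃ c : Fin ⌊(X' : ℝ) ^ 2 * (Ψ X * ω X) / 160⌋₊ → ℚ,
        Function.Injective c ∧ ∀ j, c j ∈ nodeSet Ψ ω w₀ X' ∧ w.den < (c j).den ∧
        contactInterval Ψ ω (c j) ⊆ contactInterval Ψ ω w ∧ (c j : ℝ) ∈ contactInterval Ψ ω w ∧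
        ∀ x ∈ contactInterval Ψ ω (c j), ∀ v : ℚ, w.den ≤ v.den → v.den < (c j).den →
          (1 - ω v.den) * Ψ v.den ≤ |x - v| := by
  have hfin : (nodeSet Ψ ω w₀ X).Finite :=
    (Rat.finite_den_le w₀ (w₀ + 1) X).subset fun w hw => ⟨hw.2.2.1, hw.2.2.2.2.1⟩
  have hX0 : (0 : ℝ) < X := by exact_mod_cast hX
  have hf := h.mul_pos hX0
  have hchild := (eventually_all_finite hfin).2 fun w hw =>
    h.eventually_exists_children hQ (hw₀.trans hw.1) hw.2.2.2.1
  have hlarge : Tendsto (fun X' : ℕ => (X' : ℝ) ^ 2 * (Ψ X * ω X) / 160) atTop atTop :=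
    (((tendsto_pow_atTop (by norm_num)).comp tendsto_natCast_atTop_atTop).atTop_mul_const
      hf).atTop_div_const (by norm_num)
  obtain ⟨X', hX', hc, hl, hXX'⟩ := ((h.frequently_le_sq_mul_rpow hs hlt
    (320 / (Ψ X * ω X))).and_eventually (hchild.and ((hlarge.eventually_ge_atTop 2).and
      (eventually_gt_atTop X)))).exists
  refine ⟨X', hXX', hl, hX', fun w hw => ?_⟩
  obtain ⟨F, hF, hFprop⟩ := hc w hw
  have hcard : ⌊(X' : ℝ) ^ 2 * (Ψ X * ω X) / 160⌋₊ ≤ F.card := by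
    refine Nat.floor_le_of_le (le_trans ?_ hF)
    have := h.mul_anti w.cast_den_pos (b := X) (by exact_mod_cast hw.2.2.1)
    gcongr
  refine ⟨fun j => (F.equivFin.symm (Fin.castLE hcard j) : ℚ), ?_, fun j => ?_⟩
  · exact Subtype.val_injective.comp
      (F.equivFin.symm.injective.comp (Fin.castLE_injective hcard))
  · obtain ⟨h1, h2, h3, h4, h5, h6, h7⟩ := hFprop _ (F.equivFin.symm (Fin.castLE hcard j)).2
    exact ⟨⟨hw.1.trans h3.le, h1, h2, h4, hw.2.2.2.2.2 h6, h5.trans hw.2.2.2.2.2⟩, h3, h5, h6, h7⟩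

lemma ofReal_le_dimH_exactSet (h : Admissible Ψ ω) {s : ℝ} (hs : 0 < s)
    (hlt : ENNReal.ofReal s < convergenceExponent Ψ ω) :
    ENNReal.ofReal s ≤ dimH (exactSet Ψ ω) := by
  obtain ⟨Q, hQ⟩ := h.exists_isThreshold
  obtain ⟨w₀, hw₀, hremote⟩ := exists_isRemote hQ
  have hw₀d := w₀.cast_den_pos
  have hnext : ∀ X : ℕ, ∃ X' : ℕ, 0 < X → X < X' ∧ 2 ≤ (X' : ℝ) ^ 2 * (Ψ X * ω X) / 160 ∧
      320 / (Ψ X * ω X) ≤ (X' : ℝ) ^ 2 * (Ψ X' * ω X') ^ s ∧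
      ∀ w ∈ nodeSet Ψ ω w₀ X, ∃ c : Fin ⌊(X' : ℝ) ^ 2 * (Ψ X * ω X) / 160⌋₊ → ℚ,
        Function.Injective c ∧ ∀ j, c j ∈ nodeSet Ψ ω w₀ X' ∧ w.den < (c j).den ∧
        contactInterval Ψ ω (c j) ⊆ contactInterval Ψ ω w ∧ (c j : ℝ) ∈ contactInterval Ψ ω w ∧
        ∀ x ∈ contactInterval Ψ ω (c j), ∀ v : ℚ, w.den ≤ v.den → v.den < (c j).den →
          (1 - ω v.den) * Ψ v.den ≤ |x - v| := by
    intro X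
    by_cases hX : 0 < X
    · obtain ⟨X', hX'⟩ := h.exists_next_level hQ hw₀ hs hlt hX
      exact ⟨X', fun _ => hX'⟩
    · exact ⟨0, fun hX' => absurd hX' hX⟩
  choose next hnext1 using hnext
  have hchild : ∀ (X : ℕ) (w : ℚ), ∃ c : Fin ⌊(next X : ℝ) ^ 2 * (Ψ X * ω X) / 160⌋₊ → ℚ,
      0 < X → w ∈ nodeSet Ψ ω w₀ X →
        Function.Injective c ∧ ∀ j, c j ∈ nodeSet Ψ ω w₀ (next X) ∧ w.den < (c j).den ∧
        contactInterval Ψ ω (c j) ⊆ contactInterval Ψ ω w ∧ (c j : ℝ) ∈ contactInterval Ψ ω w ∧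
        ∀ x ∈ contactInterval Ψ ω (c j), ∀ v : ℚ, w.den ≤ v.den → v.den < (c j).den →
          (1 - ω v.den) * Ψ v.den ≤ |x - v| := by
    intro X w
    by_cases hX : 0 < X ∧ w ∈ nodeSet Ψ ω w₀ X
    · obtain ⟨c, hc⟩ := (hnext1 X hX.1).2.2.2 w hX.2
      exact ⟨c, fun _ _ => hc⟩
    · exact ⟨fun _ => 0, fun h1 h2 => absurd ⟨h1, h2⟩ hX⟩
  choose child hchild1 using hchild
  obtain ⟨X, hXzero, hXsucc⟩ : ∃ X : ℕ → ℕ, X 0 = w₀.den ∧ ∀ k, X (k + 1) = next (X k) :=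
    ⟨fun k => Nat.rec w₀.den (fun _ Y => next Y) k, rfl, fun _ => rfl⟩
  have hXpos : ∀ k, 0 < X k := by
    intro k
    induction k with
    | zero => exact hXzero ▸ w₀.den_pos
    | succ k ih => exact hXsucc k ▸ (Nat.zero_le _).trans_lt (hnext1 _ ih).1
  have hXmono : StrictMono X := strictMono_nat_of_lt_succ fun k =>
    hXsucc k ▸ (hnext1 _ (hXpos k)).1
  let n : ℕ → ℕ := fun k => ⌊(next (X k) : ℝ) ^ 2 * (Ψ (X k) * ω (X k)) / 160⌋₊
  let node : ℕ → (∀ k, Fin (n k)) → ℚ := fun k a =>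
    Nat.rec w₀ (fun k w => child (X k) w (a k)) k
  have hnode0 : ∀ a, node 0 a = w₀ := fun a => rfl
  have hnodesucc : ∀ k a, node (k + 1) a = child (X k) (node k a) (a k) := fun k a => rfl
  have hnode : ∀ k a, node k a ∈ nodeSet Ψ ω w₀ (X k) := by
    intro k a
    induction k with
    | zero =>
      have h1 : Ψ w₀.den ≤ 1 := by
        have h2 := hQ.sq_mul_le _ hw₀
        have h3 : (1 : ℝ) ≤ (w₀.den : ℝ) ^ 2 := one_le_pow₀ (by exact_mod_cast w₀.den_pos)
        have h4 := h.pos _ hw₀d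
        nlinarith
      have h5 := h.mul_le hw₀d
      rw [hXzero]
      refine ⟨le_rfl, ?_, le_rfl, hremote, ⟨le_rfl, by simp [hnode0]⟩, ?_⟩
      · change (w₀.den : ℝ) / 40 ≤ w₀.den
        linarith
      · refine Icc_subset_Icc ?_ ?_
        · rw [hnode0]; linarith
        · rw [hnode0]; linarith
    | succ k ih => exact hXsucc k ▸ ((hchild1 (X k) (node k a) (hXpos k) ih).2 (a k)).1
  have hstep := fun k a => (hchild1 (X k) (node k a) (hXpos k) (hnode k a)).2 (a k)
  have hfpos : ∀ k, 0 < Ψ (X k) * ω (X k) := fun k => h.mul_pos (by exact_mod_cast hXpos k)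
  -- The floor of a number that is at least 2 is at least half of it.
  have hnlarge : ∀ k, (X (k + 1) : ℝ) ^ 2 * (Ψ (X k) * ω (X k)) / 320 ≤ n k := by
    intro k
    have h1 := (hnext1 _ (hXpos k)).2.1
    rw [← hXsucc] at h1
    have h2 := Nat.lt_floor_add_one ((next (X k) : ℝ) ^ 2 * (Ψ (X k) * ω (X k)) / 160)
    change _ < (n k : ℝ) + 1 at h2
    rw [← hXsucc] at h2
    linarith
  have hn2 : ∀ k, 2 ≤ n k := fun k => Nat.le_floor (by
    have h1 := (hnext1 _ (hXpos k)).2.1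
    exact_mod_cast h1)
  have hXsq : ∀ k, (0 : ℝ) < (X k : ℝ) ^ 2 := fun k => by have := hXpos k; positivity
  have hsep : ∀ k a b, node k a ≠ node k b → ∀ x ∈ contactInterval Ψ ω (node k a),
      ∀ y ∈ contactInterval Ψ ω (node k b), 1 / (2 * (X k : ℝ) ^ 2) ≤ |x - y| :=
    fun k a b hab x hx y hy => h.one_div_le_abs_sub_of_mem_nodeSet hQ hw₀ (hXpos k) (hnode k a)
      (hnode k b) hab hx hy
  refine le_dimH_of_tree hn2 hs (h.lt_one_of_lt_convergenceExponent hs hlt).le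
    -- The summand 1 serves levels `k ≥ 1`; the negative power serves the root, whose mass is 1.
    (A := 640 ^ s * (1 + (Ψ (X 0) * ω (X 0)) ^ (-s))) (node := node)
    (lo := fun w => (w : ℝ) + Ψ w.den - Ψ w.den * ω w.den) (hi := fun w => (w : ℝ) + Ψ w.den)
    (δ := fun k => 1 / (2 * (X k : ℝ) ^ 2)) ?_ ?_ ?_ ?_ ?_ ?_ ?_ ?_ hsep ?_ ?_
  · have := hfpos 0
    positivity
  · intro k
    induction k with
    | zero => exact measurable_const
    | succ k ih =>
      exact (Measurable.of_discrete (f := fun p : ℚ × Fin (n k) => child (X k) p.1 p.2)).comp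
        (ih.prodMk (measurable_pi_apply k))
  · intro k a b
    induction k with
    | zero => intro _ i hi; omega
    | succ k ih =>
      intro hab i hi
      -- A child lies in the contact interval of its parent, and these intervals are separated, so a
      -- child determines its parent.
      have hpar : node k a = node k b := by
        by_contra hne
        have h1 := hsep k a b hne _ (hstep k a).2.2.2.1 _ (hstep k b).2.2.2.1
        rw [← hnodesucc, ← hnodesucc, hab, sub_self, abs_zero] at h1
        have := hXsq k
        have : 0 < 1 / (2 * (X k : ℝ) ^ 2) := by positivity
        linarith
      rcases Nat.lt_succ_iff_lt_or_eq.1 hi with hi' | rfl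
      · exact ih hpar i hi'
      · rw [hnodesucc, hnodesucc, hpar] at hab
        exact (hchild1 (X i) (node i b) (hXpos i) (hnode i b)).1 hab
  · intro k a
    have := h.mul_pos (node k a).cast_den_pos
    linarith
  · intro k a
    have hsub := (hstep k a).2.2.1
    rw [← hnodesucc] at hsub
    have h1 := h.mul_pos (node (k + 1) a).cast_den_pos
    exact (hsub (left_mem_Icc.2 (by linarith))).1
  · intro k a
    have hsub := (hstep k a).2.2.1
    rw [← hnodesucc] at hsub
    have h1 := h.mul_pos (node (k + 1) a).cast_den_pos
    exact (hsub (right_mem_Icc.2 (by linarith))).2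
  · intro k
    have := hXsq k
    positivity
  · have h1 : Tendsto (fun k => 2 * (X k : ℝ) ^ 2) atTop atTop :=
      (((tendsto_pow_atTop (by norm_num)).comp tendsto_natCast_atTop_atTop).comp
        hXmono.tendsto_atTop).const_mul_atTop (by norm_num)
    exact tendsto_const_nhds.div_atTop h1
  · intro k
    have hfk := hfpos k
    have hnk := hnlarge k
    have hXk := hXsq (k + 1)
    have h1 : Ψ (X k) * ω (X k) / 640 ≤ n k * (1 / (2 * (X (k + 1) : ℝ) ^ 2)) := by
      rw [mul_one_div, le_div_iff₀ (by positivity)]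
      linarith
    have h2 : (Ψ (X k) * ω (X k)) ^ s ≤ 640 ^ s * (n k * (1 / (2 * (X (k + 1) : ℝ) ^ 2))) ^ s := by
      rw [← Real.mul_rpow (by norm_num) (by positivity)]
      exact Real.rpow_le_rpow hfk.le (by linarith) hs.le
    have hf0 := hfpos 0
    have hf0s : 0 < (Ψ (X 0) * ω (X 0)) ^ (-s) := by positivity
    have h3 : (1 + (Ψ (X 0) * ω (X 0)) ^ (-s)) * (Ψ (X k) * ω (X k)) ^ s ≤
        640 ^ s * (1 + (Ψ (X 0) * ω (X 0)) ^ (-s)) *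
          (n k * (1 / (2 * (X (k + 1) : ℝ) ^ 2))) ^ s := by
      calc _ ≤ (1 + (Ψ (X 0) * ω (X 0)) ^ (-s)) *
            (640 ^ s * (n k * (1 / (2 * (X (k + 1) : ℝ) ^ 2))) ^ s) := by gcongr
        _ = _ := by ring
    refine le_trans ?_ h3
    have hfks : 0 < (Ψ (X k) * ω (X k)) ^ s := by positivity
    rcases k with _ | k
    · rw [Finset.prod_range_zero, add_mul, ← Real.rpow_add hf0, neg_add_cancel, Real.rpow_zero]
      linarith
    · rw [Finset.prod_range_succ]
      have hprod : ∏ i ∈ Finset.range k, (1 / (n i : ℝ)) ≤ 1 := by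
        refine Finset.prod_le_one (fun i _ => by positivity) fun i _ => ?_
        have : (2 : ℝ) ≤ n i := by exact_mod_cast hn2 i
        rw [div_le_one (by linarith)]
        linarith
      have hfk' := hfpos k
      have hXk' := hXsq (k + 1)
      -- The choice of scale makes the last factor `1 / n k` alone at most `(Ψ ω) ^ s` at `X (k +
      -- 1)`; earlier factors are bounded by 1.
      have hinv : 1 / (n k : ℝ) ≤ (Ψ (X (k + 1)) * ω (X (k + 1))) ^ s := by
        have h5 := (hnext1 _ (hXpos k)).2.2.1
        rw [← hXsucc, div_le_iff₀ hfk'] at h5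
        have h6 := hnlarge k
        have hn0 : (0 : ℝ) < n k := by have := hn2 k; positivity
        rw [div_le_iff₀ hn0]
        have h7 : (Ψ (X (k + 1)) * ω (X (k + 1))) ^ s *
            ((X (k + 1) : ℝ) ^ 2 * (Ψ (X k) * ω (X k)) / 320) ≤
            (Ψ (X (k + 1)) * ω (X (k + 1))) ^ s * n k := by gcongr
        linarith
      calc (∏ i ∈ Finset.range k, (1 / (n i : ℝ))) * (1 / (n k : ℝ))
          ≤ 1 * (Ψ (X (k + 1)) * ω (X (k + 1))) ^ s := by gcongr
        _ ≤ _ := by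
          gcongr
          linarith
  · intro a x hx
    refine h.mem_exactSet_of_chain hQ (w := fun k => node k a) hw₀ hremote ?_ hx ?_
    · exact strictMono_nat_of_lt_succ fun k => (hstep k a).2.1
    · exact fun k v hv1 hv2 => (hstep k a).2.2.2.2 x (hx (k + 1)) v hv1 hv2

lemma dimH_exactSet (h : Admissible Ψ ω) : dimH (exactSet Ψ ω) = convergenceExponent Ψ ω := by
  refine le_antisymm h.dimH_exactSet_le (le_of_forall_lt fun c hc => ?_)
  obtain ⟨s, hs1, hs2⟩ := ENNReal.lt_iff_exists_nnreal_btwn.1 hc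
  have hs0 : (0 : ℝ) < s := by
    have h0 : (0 : ℝ≥0∞) < s := bot_le.trans_lt hs1
    exact_mod_cast h0
  have := h.ofReal_le_dimH_exactSet hs0 (by rwa [ENNReal.ofReal_coe_nnreal])
  rw [ENNReal.ofReal_coe_nnreal] at this
  exact hs1.trans_le this

end Admissible

theorem mainTheorem1 (Ψ ω : ℝ → ℝ)
    (hΨ_pos : ∀ q : ℝ, 0 < q → 0 < Ψ q)
    (hω_mem : ∀ q : ℝ, 0 < q → 0 < ω q ∧ ω q < 1)
    (hΨ_anti : AntitoneOn (fun q : ℝ => q ^ 2 * Ψ q) (Ioi 0))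
    (hΨω_anti : AntitoneOn (fun q : ℝ => q ^ 2 * Ψ q * ω q) (Ioi 0))
    (hΨ_div : SquareDivisibility Ψ)
    (hΨ_sum : Summable fun q : ℕ => (q : ℝ) * Ψ q)
    (hω_lim : Tendsto ω atTop (𝓝 0))
    (hω_ge : ∀ᶠ q : ℕ in atTop, 45 / (16 * Ψ q) * Ψ (1 / (8 * Ψ q)) ≤ ω q) :
    dimH (exactSet Ψ ω) = convergenceExponent Ψ ω ∧
      ((convergenceExponent Ψ ω : ℝ≥0∞) : EReal) = 2 / lowerOrder Ψ ω := by
  have h : Admissible Ψ ω :=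
    ⟨hΨ_pos, hω_mem, hΨ_anti, hΨω_anti, hΨ_div, hΨ_sum, hω_lim, hω_ge⟩
  exact ⟨h.dimH_exactSet, h.convergenceExponent_eq⟩
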